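/- Let $K$ be a nonarchimedean local field with canonical absolute value $|\cdot|$, ring of integers $R=\{x\in K:|x|\le 1\}$ and residue field of cardinality $q$, normalized so that a uniformizer has absolute value $q^{-1}$. Endow $\mathbb{P}^1(K)$ with the quotient topology from $K^2\setminus\{(0,0)\}$, the spherical metric $$\delta([x_0:x_1],[y_0:y_1])=\frac{|x_0y_1-x_1y_0|}{\max\{|x_0|,|x_1|\}\cdot\max\{|y_0|,|y_1|\}},$$ and the (unique) Borel probability measure $\nu$ satisfying $\nu(\phi(M))=\nu(M)$ for all $\phi\in PGL_2(R)$ and all Borel sets $M$. Let $N\ge 2$ and $[N]=\{1,\dots,N\}$. A splitting chain of order $N$ is a tuple $\Sigma=(\pi_0,\dots,\pi_L)$, $L\ge 1$, of partitions of $[N]$ with $\{[N]\}=\pi_0>\pi_1>\dots>\pi_L=\{\{1\},\dots,\{N\}\}$, where $>$ means "is properly refined by". Its set of branches $\mathcal{B}(\Sigma)$ consists of all non-singleton parts of $\pi_0,\dots,\pi_L$. For a branch $\lambda$ put $\ell_\Sigma(\lambda)=\max\{\ell:\lambda\in\pi_\ell\}$ and $\deg_\Sigma(\lambda)=\#\{\lambda'\in\pi_{\ell_\Sigma(\lambda)+1}:\lambda'\subset\lambda\}$.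 The chain is reduced if each branch $\lambda$ satisfies $\lambda\in\pi_\ell\iff\ell=\ell_\Sigma(\lambda)$; $\mathcal{R}_N$ is the (finite) set of reduced splitting chains of order $N$. For a complex tuple $s=(s_{ij})_{1\le i<j\le N}$ and $\lambda\subset[N]$ let $$e_\lambda(s)=\#\lambda-1+\sum_{i<j;\ i,j\in\lambda}s_{ij},\qquad \Omega_N=\{s:\operatorname{Re}(e_\lambda(s))>0\text{ for all }\lambda\subset[N]\text{ with }\#\lambda>1\}.$$ Write $(z)_n=z(z-1)\cdots(z-n+1)\in\mathbb{Z}[z]$. Theorem. The integral $$\mathcal{Z}_N(\mathbb{P}^1(K),s)=\int_{\mathbb{P}^1(K)^N}\prod_{1\le i<j\le N}\delta(x_i,x_j)^{s_{ij}}\,d\nu^N$$ converges absolutely if and only if $s\in\Omega_N$, and in this case $$\mathcal{Z}_N(\mathbb{P}^1(K),s)=\frac{1}{(q+1)^{N-1}}\sum_{\Sigma\in\mathcal{R}_N}\frac{q^{N+\sum_{i<j}s_{ij}}+1-\deg_\Sigma([N])}{q+1-\deg_\Sigma([N])}\prod_{\lambda\in\mathcal{B}(\Sigma)}\frac{(q-1)_{\deg_\Sigma(\lambda)-1}}{q^{e_\lambda(s)}-1}.$$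 The summand is defined for every $\Sigma\in\mathcal{R}_N$ (also when $\deg_\Sigma([N])=q+1$): with $d=\deg_\Sigma([N])\ge 2$, the denominator $q+1-d$ is cancelled by the factor $(q-1)_{d-1}$ in the product, through the polynomial identity $(z)_{d-1}=(z+2-d)\,(z)_{d-2}$ at $z=q-1$. -/

import Mathlib

open MeasureTheory Polynomial
open scoped LinearAlgebra.Projectivization ValuativeRel NNReal

namespace LogCoulomb

noncomputable section LocalField

variable (K : Type*) [Field K] [ValuativeRel K] [TopologicalSpace K] [IsNonarchimedeanLocalField K]

/-- The cardinality `q` of the residue field of the ring of integers `R = 𝒪[K]`. -/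
def resCard : ℕ := Nat.card 𝓀[K]

theorem resCard_pos : 0 < resCard K := Nat.card_pos

theorem resCard_ne_zero : ((resCard K : ℕ) : ℝ≥0) ≠ 0 :=
  Nat.cast_ne_zero.mpr (resCard_pos K).ne'

/-- The canonical (normalized) absolute value of `K`: the valuation of `K`, with its value group
identified with `ℤ` as an ordered group, composed with `n ↦ q ^ n`; so `|π| = q⁻¹` for a
uniformizer `π`. -/
def canonicalAbs : K →*₀ ℝ≥0 where
  toFun x := WithZeroMulInt.toNNReal (resCard_ne_zero K)
    (IsNonarchimedeanLocalField.valueGroupWithZeroIsoInt K (ValuativeRel.valuation K x))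
  map_zero' := by simp
  map_one' := by simp
  map_mul' x y := by simp

end LocalField

noncomputable section ProjectiveLine

/-- The projective line over `K`. -/
abbrev P1 (K : Type*) [Field K] : Type _ := ℙ K (Fin 2 → K)

/-- The quotient topology on the projective line, induced by `(x₀, x₁) ↦ [x₀ : x₁]`. -/
instance instTopologicalSpaceP1 (K : Type*) [Field K] [TopologicalSpace K] :
    TopologicalSpace (P1 K) :=
  TopologicalSpace.coinduced
    (Projectivization.mk' K : {v : Fin 2 → K // v ≠ 0} → P1 K) inferInstance

/-- The Borel σ-algebra of the projective line. -/
instance instMeasurableSpaceP1 (K : Type*) [Field K] [TopologicalSpace K] :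
    MeasurableSpace (P1 K) := borel (P1 K)

instance instBorelSpaceP1 (K : Type*) [Field K] [TopologicalSpace K] : BorelSpace (P1 K) := ⟨rfl⟩

/-- `GL₂(R)`, where `R = 𝒪[K]` is the closed unit ball of `K`. -/
abbrev GL2R (K : Type*) [Field K] [ValuativeRel K] : Type _ := GL (Fin 2) 𝒪[K]

/-- The action of `GL₂(R)` (hence of its quotient `PGL₂(R)`) on the projective line:
`[x₀ : x₁] ↦ [a x₀ + b x₁ : c x₀ + d x₁]`. -/
def moebius {K : Type*} [Field K] [ValuativeRel K] (g : GL2R K) (x : P1 K) : P1 K :=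
  Matrix.GeneralLinearGroup.map (algebraMap 𝒪[K] K) g • x

theorem moebius_mk {K : Type*} [Field K] [ValuativeRel K] (g : GL2R K) (v : Fin 2 → K) (hv : v ≠ 0) :
    ∃ hw, moebius g (Projectivization.mk K v hv) = Projectivization.mk K
      ![(g 0 0 : K) * v 0 + (g 0 1 : K) * v 1, (g 1 0 : K) * v 0 + (g 1 1 : K) * v 1] hw := by
  have key : Matrix.GeneralLinearGroup.map (algebraMap 𝒪[K] K) g • v =
      ![(g 0 0 : K) * v 0 + (g 0 1 : K) * v 1, (g 1 0 : K) * v 0 + (g 1 1 : K) * v 1] := by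
    ext i
    fin_cases i <;>
      simp [Units.smul_def, Matrix.smul_eq_mulVec, Matrix.mulVec, dotProduct, Fin.sum_univ_two] <;> rfl
  have hw : Matrix.GeneralLinearGroup.map (algebraMap 𝒪[K] K) g • v ≠ 0 :=
    (smul_ne_zero_iff_ne _).2 hv
  refine ⟨key ▸ hw, ?_⟩
  have : moebius g (Projectivization.mk K v hv) = Projectivization.mk K _ hw := rfl
  rw [this]
  congr 1

variable (K : Type*) [Field K] [ValuativeRel K] [TopologicalSpace K] [IsNonarchimedeanLocalField K]

variable {K} in
/-- The spherical metric, computed from representatives of the two points; the choice of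
representatives is immaterial, see `sphericalDist_mk`. -/
def sphericalDist (x y : P1 K) : ℝ :=
  (canonicalAbs K (x.rep 0 * y.rep 1 - x.rep 1 * y.rep 0) : ℝ) /
    (max (canonicalAbs K (x.rep 0) : ℝ) (canonicalAbs K (x.rep 1)) *
      max (canonicalAbs K (y.rep 0) : ℝ) (canonicalAbs K (y.rep 1)))

theorem sphericalDist_mk (v w : Fin 2 → K) (hv : v ≠ 0) (hw : w ≠ 0) :
    sphericalDist (Projectivization.mk K v hv) (Projectivization.mk K w hw) =
      (canonicalAbs K (v 0 * w 1 - v 1 * w 0) : ℝ) /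
        (max (canonicalAbs K (v 0) : ℝ) (canonicalAbs K (v 1)) *
          max (canonicalAbs K (w 0) : ℝ) (canonicalAbs K (w 1))) := by
  obtain ⟨a, ha⟩ := Projectivization.exists_smul_eq_mk_rep K v hv
  obtain ⟨b, hb⟩ := Projectivization.exists_smul_eq_mk_rep K w hw
  have key : ∀ c : Kˣ, (canonicalAbs K (c : K) : ℝ) ≠ 0 := fun c => by
    simp
  unfold sphericalDist
  rw [← ha, ← hb]
  simp only [Pi.smul_apply, Units.smul_def, smul_eq_mul, map_mul, NNReal.coe_mul]
  rw [← mul_max_of_nonneg _ _ (NNReal.coe_nonneg _), ← mul_max_of_nonneg _ _ (NNReal.coe_nonneg _),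
    show (a : K) * v 0 * (b * w 1) - a * v 1 * (b * w 0) = a * b * (v 0 * w 1 - v 1 * w 0) by ring]
  simp only [map_mul, NNReal.coe_mul]
  have h1 := key a
  have h2 := key b
  rw [show (canonicalAbs K (a : K) : ℝ) *
        max (canonicalAbs K (v 0) : ℝ) (canonicalAbs K (v 1)) *
      ((canonicalAbs K (b : K) : ℝ) * max (canonicalAbs K (w 0) : ℝ) (canonicalAbs K (w 1))) =
      ((canonicalAbs K (a : K) : ℝ) * canonicalAbs K (b : K)) *
        (max (canonicalAbs K (v 0) : ℝ) (canonicalAbs K (v 1)) *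
          max (canonicalAbs K (w 0) : ℝ) (canonicalAbs K (w 1))) by ring]
  exact mul_div_mul_left _ _ (mul_ne_zero h1 h2)

variable {K} in
/-- `PGL₂(R)`-invariance of a measure on the projective line: `ν (φ M) = ν M` for every `φ` and
every Borel set `M`. -/
def IsPGLInvariant (ν : Measure (P1 K)) : Prop :=
  ∀ g : GL2R K, ∀ M : Set (P1 K), MeasurableSet M → ν (moebius g '' M) = ν M

theorem exists_invariant : ∃ ν : Measure (P1 K), IsProbabilityMeasure ν ∧ IsPGLInvariant ν := by
  let : MeasurableSpace (GL2R K) := borel _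
  have : BorelSpace (GL2R K) := ⟨rfl⟩
  have : CompactSpace (Matrix (Fin 2) (Fin 2) 𝒪[K]) :=
    inferInstanceAs (CompactSpace (Fin 2 → Fin 2 → 𝒪[K]))
  have : T2Space K := by
    let := IsTopologicalAddGroup.rightUniformSpace K
    have := isUniformAddGroup_of_addCommGroup (G := K)
    infer_instance
  have : T2Space 𝒪[K] := inferInstance
  have : IsTopologicalRing 𝒪[K] := inferInstance
  have : CompactSpace (GL2R K) := inferInstance
  have : T2Space (GL2R K) := inferInstance
  have : IsTopologicalGroup (GL2R K) := inferInstance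
  have he : (![1, 0] : Fin 2 → K) ≠ 0 := fun h => one_ne_zero (congrFun h 0)
  let o : P1 K := Projectivization.mk K ![1, 0] he
  have hcont : ∀ x : P1 K, Continuous fun g : GL2R K => moebius g x := by
    intro x
    induction x using Projectivization.ind with
    | h v hv =>
      have h0 : ∀ g : GL2R K, Matrix.GeneralLinearGroup.map (algebraMap 𝒪[K] K) g • v ≠ 0 :=
        fun g => (smul_ne_zero_iff_ne _).2 hv
      have h1 : Continuous fun g : GL2R K =>
          Matrix.GeneralLinearGroup.map (algebraMap 𝒪[K] K) g • v := by
        refine continuous_pi fun i => ?_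
        simp only [Units.smul_def, Matrix.smul_eq_mulVec, Matrix.mulVec, dotProduct,
          Fin.sum_univ_two]
        have h2 : ∀ j, Continuous fun g : GL2R K =>
            ((Matrix.GeneralLinearGroup.map (algebraMap 𝒪[K] K) g).1 i j) := by
          intro j
          exact continuous_subtype_val.comp
            ((Units.continuous_val (M := Matrix (Fin 2) (Fin 2) 𝒪[K])).matrix_elem i j)
        exact ((h2 0).mul continuous_const).add ((h2 1).mul continuous_const)
      exact continuous_coinduced_rng.comp (h1.subtype_mk h0)
  have hcont' : ∀ g : GL2R K, Continuous fun x : P1 K => moebius g x := by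
    intro g
    refine continuous_coinduced_dom.mpr ?_
    have h0 : ∀ v : {v : Fin 2 → K // v ≠ 0},
        Matrix.GeneralLinearGroup.map (algebraMap 𝒪[K] K) g • (v : Fin 2 → K) ≠ 0 :=
      fun v => (smul_ne_zero_iff_ne _).2 v.2
    have h1 : Continuous fun v : {v : Fin 2 → K // v ≠ 0} =>
        Matrix.GeneralLinearGroup.map (algebraMap 𝒪[K] K) g • (v : Fin 2 → K) := by
      refine continuous_pi fun i => ?_
      simp only [Units.smul_def, Matrix.smul_eq_mulVec, Matrix.mulVec, dotProduct,
        Fin.sum_univ_two]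
      have h2 : ∀ j, Continuous fun v : {v : Fin 2 → K // v ≠ 0} => (v : Fin 2 → K) j :=
        fun j => (continuous_apply j).comp continuous_subtype_val
      exact (continuous_const.mul (h2 0)).add (continuous_const.mul (h2 1))
    exact continuous_coinduced_rng.comp (h1.subtype_mk h0)
  have hmul : ∀ (g h : GL2R K) (x : P1 K), moebius (g * h) x = moebius g (moebius h x) := by
    intro g h x
    simp [moebius, mul_smul]
  have hone : ∀ x : P1 K, moebius 1 x = x := by
    intro x
    simp [moebius]
  let μ : Measure (GL2R K) := Measure.haarMeasure ⊤
  have hμ : IsProbabilityMeasure μ := ⟨Measure.haarMeasure_self (K₀ := ⊤)⟩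
  refine ⟨μ.map fun g => moebius g o, ?_, ?_⟩
  · exact Measure.isProbabilityMeasure_map (hcont o).measurable.aemeasurable
  · intro g M hM
    have him : moebius g '' M = moebius g⁻¹ ⁻¹' M := by
      ext y
      constructor
      · rintro ⟨x, hx, rfl⟩
        simpa [← hmul, hone] using hx
      · intro hy
        exact ⟨_, hy, by rw [← hmul, mul_inv_cancel, hone]⟩
    have hM' : MeasurableSet (moebius g⁻¹ ⁻¹' M) := (hcont' g⁻¹).measurable hM
    rw [him, Measure.map_apply (hcont o).measurable hM',
      Measure.map_apply (hcont o).measurable hM,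
      ← measure_preimage_mul μ g⁻¹ ((fun g => moebius g o) ⁻¹' M)]
    congr 1
    ext h
    simp [hmul]

end ProjectiveLine

noncomputable section Chains

/-- A splitting chain of order `N`: a tuple `(⋔₀, …, ⋔_L)`, `L ≥ 1`, of partitions of `[N]`,
strictly refining at each step, from the one-part partition to the partition into singletons.
(In `Finpartition`, `P < Q` means that `P` properly refines `Q`.) -/
structure SplittingChain (N : ℕ) where
  length : ℕ
  length_pos : 1 ≤ length
  ptn : Fin (length + 1) → Finpartition (Finset.univ : Finset (Fin N))
  strictAnti : StrictAnti ptn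
  ptn_first : (ptn 0).parts = {Finset.univ}
  ptn_last : (ptn (Fin.last length)).parts = Finset.univ.image (fun i : Fin N => {i})

namespace SplittingChain

variable {N : ℕ} (c : SplittingChain N)

/-- The branches: all non-singleton parts of the partitions in the chain. -/
def branches : Finset (Finset (Fin N)) :=
  {lam ∈ Finset.univ.biUnion (fun l => (c.ptn l).parts) | 1 < lam.card}

/-- The depth of a branch: the largest `ℓ` such that `lam` is a part of the `ℓ`-th partition. -/
def depth (lam : Finset (Fin N)) : ℕ :=
  (Finset.univ.filter (fun l : Fin (c.length + 1) => lam ∈ (c.ptn l).parts)).sup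
    (fun l => (l : ℕ))

/-- The degree of a branch: the number of parts of the partition following the depth of `lam`
that are contained in `lam`. -/
def deg (lam : Finset (Fin N)) : ℕ :=
  (Finset.univ.filter (fun lam' : Finset (Fin N) => lam' ⊆ lam ∧
    ∃ l : Fin (c.length + 1), (l : ℕ) = c.depth lam + 1 ∧ lam' ∈ (c.ptn l).parts)).card

/-- A chain is reduced if each branch is a part of exactly one of its partitions. -/
def IsReduced : Prop :=
  ∀ lam ∈ c.branches, ∀ l : Fin (c.length + 1),
    lam ∈ (c.ptn l).parts ↔ (l : ℕ) = c.depth lam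

theorem length_le : c.length < Fintype.card (Finpartition (Finset.univ : Finset (Fin N))) := by
  have := Fintype.card_le_of_injective c.ptn c.strictAnti.injective
  simpa using this

instance : Finite (SplittingChain N) := by
  let f : SplittingChain N →
      (Σ L : Fin (Fintype.card (Finpartition (Finset.univ : Finset (Fin N)))),
        (Fin ((L : ℕ) + 1) → Finpartition (Finset.univ : Finset (Fin N)))) :=
    fun c => ⟨⟨c.length, c.length_le⟩, c.ptn⟩
  refine Finite.of_injective f ?_
  rintro ⟨L, h1, p, h2, h3, h4⟩ ⟨L', h1', p', h2', h3', h4'⟩ h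
  simp only [f, Sigma.mk.injEq, Fin.mk.injEq] at h
  obtain ⟨rfl, h⟩ := h
  simp only [heq_eq_eq] at h
  subst h
  rfl

end SplittingChain

/-- The set `𝓡_N` of reduced splitting chains of order `N`. -/
abbrev ReducedChain (N : ℕ) : Type := {c : SplittingChain N // c.IsReduced}

instance (N : ℕ) : Fintype (ReducedChain N) := Fintype.ofFinite _

/-- `e_λ(s) = #λ - 1 + ∑_{i < j, i, j ∈ λ} s_{ij}`. A tuple `(s_{ij})_{i < j}` is given as a
function of `i` and `j` of which only the values with `i < j` are ever used. -/
def expo {N : ℕ} (s : Fin N → Fin N → ℂ) (lam : Finset (Fin N)) : ℂ :=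
  (lam.card : ℂ) - 1 + ∑ i ∈ lam, ∑ j ∈ lam with i < j, s i j

/-- The domain `Ω_N`. -/
def Omega (N : ℕ) : Set (Fin N → Fin N → ℂ) :=
  {s | ∀ lam : Finset (Fin N), 1 < lam.card → 0 < (expo s lam).re}

/-- The falling factorial `(q - 1)_n`, i.e. the polynomial `z (z - 1) ⋯ (z - n + 1)` at
`z = q - 1`. -/
def fall (q n : ℕ) : ℂ := (((descPochhammer ℤ n).eval ((q : ℤ) - 1) : ℤ) : ℂ)

/-- The factor `(q - 1)_{deg λ - 1} / (q ^ e_λ(s) - 1)` of a branch `λ`. -/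
def branchFactor {N : ℕ} (q : ℕ) (s : Fin N → Fin N → ℂ) (c : SplittingChain N)
    (lam : Finset (Fin N)) : ℂ :=
  fall q (c.deg lam - 1) / ((q : ℂ) ^ expo s lam - 1)

/-- `q ^ (N + ∑_{i<j} s_{ij}) + 1 - deg [N]`. -/
def topNumerator {N : ℕ} (q : ℕ) (s : Fin N → Fin N → ℂ) (c : SplittingChain N) : ℂ :=
  (q : ℂ) ^ ((N : ℂ) + ∑ i, ∑ j with i < j, s i j) + 1 - (c.deg Finset.univ : ℂ)

/-- The summand of a chain, `d` being the degree of `[N]`: in the expression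
`(q ^ (N + ∑ s_{ij}) + 1 - d) / (q + 1 - d) * ∏_λ (q - 1)_{deg λ - 1} / (q ^ e_λ(s) - 1)`
the denominator `q + 1 - d`, which is `0` when `d = q + 1`, is cancelled by the last linear factor
of `(q - 1)_{d - 1} = (q + 1 - d) (q - 1)_{d - 2}`. When `d ≠ q + 1` this is the displayed
expression, see `summand_eq`. -/
def summand {N : ℕ} (q : ℕ) (s : Fin N → Fin N → ℂ) (c : SplittingChain N) : ℂ :=
  topNumerator q s c * (fall q (c.deg Finset.univ - 2) / ((q : ℂ) ^ expo s Finset.univ - 1)) *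
    ∏ lam ∈ c.branches.erase Finset.univ, branchFactor q s c lam

theorem two_le_deg_univ {N : ℕ} (hN : 2 ≤ N) (c : SplittingChain N) :
    2 ≤ c.deg Finset.univ := by
  classical
  set S := Finset.univ.filter (fun l : Fin (c.length + 1) => Finset.univ ∈ (c.ptn l).parts) with hS
  have hne : S.Nonempty := ⟨0, by simp [hS, c.ptn_first]⟩
  obtain ⟨l, hl, hsup⟩ := Finset.exists_mem_eq_sup S hne (fun l => (l : ℕ))
  have hdepth : c.depth Finset.univ = (l : ℕ) := hsup
  have hmem : Finset.univ ∈ (c.ptn l).parts := (Finset.mem_filter.mp hl).2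
  have hlast : Finset.univ ∉ (c.ptn (Fin.last c.length)).parts := by
    rw [c.ptn_last]
    intro h
    obtain ⟨i, -, hi⟩ := Finset.mem_image.mp h
    have := congrArg Finset.card hi
    simp at this
    omega
  have hlt : (l : ℕ) < c.length := by
    rcases Nat.lt_or_ge (l : ℕ) c.length with h | h
    · exact h
    · exfalso
      apply hlast
      have : l = Fin.last c.length := by
        apply Fin.ext
        have := l.isLt
        simp only [Fin.val_last]
        omega
      rwa [← this]
  let m : Fin (c.length + 1) := ⟨l + 1, by omega⟩
  have hm : Finset.univ ∉ (c.ptn m).parts := by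
    intro h
    have h1 : m ∈ S := Finset.mem_filter.mpr ⟨Finset.mem_univ _, h⟩
    have h2 := Finset.le_sup (f := fun l : Fin (c.length + 1) => (l : ℕ)) h1
    rw [hsup] at h2
    simp [m] at h2
  have hsub : (c.ptn m).parts ⊆ Finset.univ.filter (fun lam' : Finset (Fin N) =>
      lam' ⊆ Finset.univ ∧ ∃ l : Fin (c.length + 1),
        (l : ℕ) = c.depth Finset.univ + 1 ∧ lam' ∈ (c.ptn l).parts) := by
    intro lam' h
    exact Finset.mem_filter.mpr ⟨Finset.mem_univ _, Finset.subset_univ _, m, by simp [m, hdepth], h⟩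
  refine le_trans ?_ (Finset.card_le_card hsub)
  by_contra hcon
  have hcard : (c.ptn m).parts.card ≤ 1 := by omega
  have hbi := (c.ptn m).biUnion_parts
  rcases Nat.le_one_iff_eq_zero_or_eq_one.mp hcard with h0 | h1
  · rw [Finset.card_eq_zero] at h0
    rw [h0] at hbi
    have := congrArg Finset.card hbi
    simp at this
    omega
  · obtain ⟨b, hb⟩ := Finset.card_eq_one.mp h1
    rw [hb] at hbi
    simp at hbi
    exact hm (by rw [hb, hbi]; simp)

theorem univ_mem_branches {N : ℕ} (hN : 2 ≤ N) (c : SplittingChain N) :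
    Finset.univ ∈ c.branches := by
  simp only [SplittingChain.branches, Finset.mem_filter, Finset.mem_biUnion, Finset.mem_univ,
    true_and, Finset.card_univ, Fintype.card_fin]
  exact ⟨⟨0, by simp [c.ptn_first]⟩, by omega⟩

/-- The cancellation of `q + 1 - d = z + 2 - d` in `(z)_{d-1}`, as polynomials in `z = q - 1`. -/
theorem descPochhammer_cancel {d : ℕ} (hd : 2 ≤ d) :
    descPochhammer ℤ (d - 1) = (X + 2 - (d : ℤ[X])) * descPochhammer ℤ (d - 2) := by
  obtain ⟨k, rfl⟩ := Nat.exists_eq_add_of_le hd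
  rw [show 2 + k - 1 = k + 1 by omega, show 2 + k - 2 = k by omega, descPochhammer_succ_right]
  push_cast
  ring

theorem fall_factor {d : ℕ} (hd : 2 ≤ d) (q : ℕ) :
    fall q (d - 1) = ((q : ℂ) + 1 - d) * fall q (d - 2) := by
  unfold fall
  rw [descPochhammer_cancel hd]
  simp only [eval_mul, eval_sub, eval_add, eval_X, eval_natCast, eval_ofNat]
  push_cast
  ring

theorem summand_eq {N : ℕ} (hN : 2 ≤ N) (q : ℕ) (s : Fin N → Fin N → ℂ) (c : SplittingChain N)
    (hq : c.deg Finset.univ ≠ q + 1) :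
    summand q s c = topNumerator q s c / ((q : ℂ) + 1 - (c.deg Finset.univ : ℂ)) *
      ∏ lam ∈ c.branches, branchFactor q s c lam := by
  have hne : (q : ℂ) + 1 - (c.deg Finset.univ : ℂ) ≠ 0 := by
    intro h
    apply hq
    have : ((c.deg Finset.univ : ℕ) : ℂ) = ((q + 1 : ℕ) : ℂ) := by
      push_cast
      linear_combination -h
    exact_mod_cast this
  rw [← Finset.mul_prod_erase _ _ (univ_mem_branches hN c)]
  unfold summand
  rw [branchFactor, fall_factor (two_le_deg_univ hN c) q]
  field_simp

end Chains

noncomputable section Integral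

variable {K : Type*} [Field K] [ValuativeRel K] [TopologicalSpace K] [IsNonarchimedeanLocalField K]

/-- The integrand `∏_{i < j} δ(x_i, x_j) ^ s_{ij}` on `P¹(K)^N`. -/
def integrand {N : ℕ} (s : Fin N → Fin N → ℂ) (x : Fin N → P1 K) : ℂ :=
  ∏ i, ∏ j with i < j, ((sphericalDist (x i) (x j) : ℝ) : ℂ) ^ s i j

end Integral

end LogCoulomb

/-! The ring R, with its Haar probability measure and the distance |x - y|, is the disjoint union of
its q residue discs. Each disc is a copy of R with distances divided by q, and points of different
discs are at distance 1. In the same way P¹(K) is a union of q + 1 such copies of R: q in the chart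
[1 : t] and one around [0 : 1]. Invariance of ν forces the copies to have equal measure and to carry
Haar measure. `IsCover` records this structure; the integration argument needs only this,
measurability and 0 ≤ |x - y| ≤ 1.

Distribute the points x_i, i ∈ S, among m such discs. Pairs in different discs contribute 1, a pair
in a common disc gains a factor q^(-s_ij), and different discs are independent. A partition P of S
arises from m(m-1)⋯(m-#P+1) distributions of the points of S. So the integral over S is a sum over P
of this number, times m^(-#S), times a product over the blocks of rescaled integrals over R
(`IsCover.integral_eq`).

For R itself m = q, and the one-block partition returns q^(-e_S) times the original integral.
Solving for that integral gives a recursion over proper subsets (`treeValue_rec`). With absolute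
values inside, the same equation decides convergence: for Re e_S > 0 it is a contraction, and
truncation with Fatou's lemma gives finiteness (`normIntegral_ne_top`); for Re e_S ≤ 0 it
contradicts finiteness (`normIntegral_eq_top`).

For P¹(K) the first subdivision has m = q + 1. Eliminating the integral over R attached to [N] turns
this into one more recursion of the same shape, with a special weight at the root
(`integral_pairProd_univ`).

Iterating the recursion, with all non-singleton blocks split at every stage, produces exactly the
reduced splitting chains (`IsTreeSum.sum_reducedChain`). -/

namespace LogCoulomb

/-! ### From a recursion over set partitions to a sum over reduced splitting chains. -/

section Combinatorics

variable {N : ℕ}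

/-- The partitions of `[N]`. -/
abbrev Ptn (N : ℕ) : Type := Finpartition (Finset.univ : Finset (Fin N))

/-- `Q` properly refines every non-singleton part of `P`, and `P` has such parts. -/
def IsStep (P Q : Ptn N) : Prop :=
  Q ≤ P ∧ P ≠ ⊥ ∧ ∀ lam ∈ P.parts, 1 < lam.card → lam ∉ Q.parts

open Classical in
/-- The weight of the passage from a partition to a refinement. -/
noncomputable def stepWeight (g : Finset (Fin N) → ℕ → ℂ) (P Q : Ptn N) : ℂ :=
  if IsStep P Q then
    ∏ lam ∈ P.parts with 1 < lam.card, g lam (Q.parts.filter (· ⊆ lam)).card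
  else 0

theorem eq_of_subset_of_mem_parts {S : Finset (Fin N)} {P : Finpartition S} {a b : Finset (Fin N)}
    (ha : a ∈ P.parts) (hb : b ∈ P.parts) (hab : a ⊆ b) : a = b := by
  obtain ⟨i, hi⟩ := P.nonempty_of_mem_parts ha
  exact P.eq_of_mem_parts ha hb hi (hab hi)

theorem exists_one_lt_card_of_ne_bot {P : Ptn N} (hP : P ≠ ⊥) : ∃ lam ∈ P.parts, 1 < lam.card := by
  by_contra! h
  apply hP
  refine le_bot_iff.mp fun lam hlam => ?_
  have h1 : lam.card = 1 :=
    le_antisymm (h lam hlam) (P.nonempty_of_mem_parts hlam).card_pos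
  obtain ⟨i, rfl⟩ := Finset.card_eq_one.mp h1
  exact ⟨{i}, by simp, le_rfl⟩

theorem IsStep.lt {P Q : Ptn N} (h : IsStep P Q) : Q < P := by
  obtain ⟨h1, h2, h3⟩ := h
  refine lt_of_le_of_ne h1 ?_
  rintro rfl
  obtain ⟨lam, hlam, hc⟩ := exists_one_lt_card_of_ne_bot h2
  exact h3 lam hlam hc hlam

theorem stepWeight_eq_zero {g : Finset (Fin N) → ℕ → ℂ} {P Q : Ptn N} (h : ¬ Q < P) :
    stepWeight g P Q = 0 := by
  rw [stepWeight, if_neg fun h' => h h'.lt]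

theorem bind_le (P : Ptn N) (p : ∀ lam ∈ P.parts, Finpartition lam) : P.bind p ≤ P := by
  intro b hb
  obtain ⟨A, hA, hb⟩ := Finpartition.mem_bind.mp hb
  exact ⟨A, hA, (p A hA).le hb⟩

theorem filter_parts_bind (P : Ptn N) (p : ∀ lam ∈ P.parts, Finpartition lam)
    {lam : Finset (Fin N)} (hlam : lam ∈ P.parts) :
    (P.bind p).parts.filter (· ⊆ lam) = (p lam hlam).parts := by
  ext b
  simp only [Finset.mem_filter, Finpartition.mem_bind]
  constructor
  · rintro ⟨⟨A, hA, hb⟩, hbl⟩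
    obtain ⟨i, hi⟩ := (p A hA).nonempty_of_mem_parts hb
    have : A = lam := P.eq_of_mem_parts hA hlam ((p A hA).le hb hi) (hbl hi)
    subst this
    exact hb
  · intro hb
    exact ⟨⟨lam, hlam, hb⟩, (p lam hlam).le hb⟩

/-- With `bind_le` and `exists_bind_eq`, this identifies the refinements of `P` with the choices of
a partition of each part of `P`. -/
theorem bind_injective (P : Ptn N) :
    Function.Injective fun p : (∀ lam ∈ P.parts, Finpartition lam) => P.bind p := by
  intro p p' h
  funext lam hlam
  have h' : P.bind p = P.bind p' := h
  apply Finpartition.ext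
  rw [← filter_parts_bind P p hlam, ← filter_parts_bind P p' hlam, h']

theorem exists_bind_eq {P Q : Ptn N} (h : Q ≤ P) : ∃ p, P.bind p = Q := by
  have hsub : ∀ lam ∈ P.parts, ∀ b ∈ Q.parts, ∀ i ∈ b, i ∈ lam → b ⊆ lam := by
    intro lam hlam b hb i hi hil
    obtain ⟨c, hc, hbc⟩ := h hb
    rwa [P.eq_of_mem_parts hlam hc hil (hbc hi)]
  refine ⟨fun lam hlam => Finpartition.ofExistsUnique (Q.parts.filter (· ⊆ lam))
    (fun b hb => (Finset.mem_filter.mp hb).2) (fun i hi => ?_)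
    (fun hb => Q.empty_notMem_parts (Finset.mem_filter.mp hb).1), ?_⟩
  · obtain ⟨t, ⟨ht, hit⟩, huniq⟩ := Q.existsUnique_mem (Finset.mem_univ i)
    refine ⟨t, ⟨Finset.mem_filter.mpr ⟨ht, hsub lam hlam t ht i hit hi⟩, hit⟩, ?_⟩
    rintro y ⟨hy, hiy⟩
    exact huniq y ⟨(Finset.mem_filter.mp hy).1, hiy⟩
  · apply Finpartition.ext
    ext b
    simp only [Finpartition.mem_bind, Finpartition.ofExistsUnique, Finset.mem_filter]
    constructor
    · rintro ⟨A, hA, hb, -⟩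
      exact hb
    · intro hb
      obtain ⟨c, hc, hbc⟩ := h hb
      exact ⟨c, hc, hb, hbc⟩

/-- A function on finsets satisfying the tree recursion with branch weights `g`. -/
structure IsTreeSum (g : Finset (Fin N) → ℕ → ℂ) (T : Finset (Fin N) → ℂ) : Prop where
  singleton : ∀ i, T {i} = 1
  rec_eq : ∀ lam, 1 < lam.card → T lam = ∑ P : Finpartition lam,
    (if lam ∈ P.parts then 0 else g lam P.parts.card) * ∏ lam' ∈ P.parts, T lam'

/-- A singleton has only the trivial partition, so with weight 1 it fits the same formula. This
uniform shape allows the product over all parts of a partition to be expanded. -/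
theorem IsTreeSum.eq_sum {g : Finset (Fin N) → ℕ → ℂ} {T : Finset (Fin N) → ℂ}
    (hT : IsTreeSum g T) {lam : Finset (Fin N)} (hlam : lam.Nonempty) :
    T lam = ∑ P : Finpartition lam,
      (if 1 < lam.card then (if lam ∈ P.parts then 0 else g lam P.parts.card) else 1) *
        ∏ lam' ∈ P.parts, T lam' := by
  split_ifs with h
  · exact hT.rec_eq lam h
  · obtain ⟨i, rfl⟩ := Finset.card_eq_one.mp (le_antisymm (not_lt.mp h) hlam.card_pos)
    have hparts : ∀ P : Finpartition ({i} : Finset (Fin N)), P.parts = {{i}} := by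
      intro P
      have hsub : ∀ b ∈ P.parts, b = {i} := fun b hb =>
        (Finset.subset_singleton_iff.mp (P.le hb)).resolve_left (P.ne_empty hb)
      exact Finset.eq_singleton_iff_nonempty_unique_mem.mpr
        ⟨P.parts_nonempty (by simp), hsub⟩
    have : Unique (Finpartition ({i} : Finset (Fin N))) :=
      { default := ⊥, uniq := fun P => Finpartition.ext (by rw [hparts, hparts]) }
    simp [hparts]

/-- Expanding the product of the recursions chooses a partition of every part at once, that is, a
refinement `Q` of `P`. A choice that keeps some non-singleton part whole has weight 0, and for `P ≠
⊥` these are exactly the refinements failing `IsStep`. -/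
theorem IsTreeSum.prod_parts {g : Finset (Fin N) → ℕ → ℂ} {T : Finset (Fin N) → ℂ}
    (hT : IsTreeSum g T) {P : Ptn N} (hP : P ≠ ⊥) :
    ∏ lam ∈ P.parts, T lam = ∑ Q, stepWeight g P Q * ∏ lam ∈ Q.parts, T lam := by
  classical
  rw [Finset.prod_congr rfl fun lam hlam => hT.eq_sum (P.nonempty_of_mem_parts hlam),
    Finset.prod_sum]
  have hle : ∑ Q, stepWeight g P Q * ∏ lam ∈ Q.parts, T lam =
      ∑ Q with Q ≤ P, stepWeight g P Q * ∏ lam ∈ Q.parts, T lam := by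
    rw [Finset.sum_filter]
    refine Finset.sum_congr rfl fun Q _ => ?_
    split_ifs with h
    · rfl
    · rw [stepWeight_eq_zero fun h' => h h'.le, zero_mul]
  rw [hle]
  refine Finset.sum_bij (fun p _ => P.bind p) (fun p _ => by simp [bind_le])
    (fun p _ p' _ h => bind_injective P h) (fun Q hQ => ?_) (fun p _ => ?_)
  · obtain ⟨p, hp⟩ := exists_bind_eq (Finset.mem_filter.mp hQ).2
    exact ⟨p, by simp, hp⟩
  · rw [Finset.prod_mul_distrib]
    congr 1
    · have hmem : ∀ lam (hlam : lam ∈ P.parts), lam ∈ (P.bind p).parts ↔ lam ∈ (p lam hlam).parts := by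
        intro lam hlam
        rw [← filter_parts_bind P p hlam]
        simp
      have hval : ∀ x ∈ P.parts.attach,
          (if 1 < x.1.card then
            (if x.1 ∈ (p x.1 x.2).parts then 0 else g x.1 (p x.1 x.2).parts.card) else 1 : ℂ) =
          if 1 < x.1.card then (if x.1 ∈ (P.bind p).parts then 0 else
            g x.1 ((P.bind p).parts.filter (· ⊆ x.1)).card) else 1 := by
        intro x _
        rw [filter_parts_bind P p x.2]
        simp only [hmem x.1 x.2]
      rw [Finset.prod_congr rfl hval, Finset.prod_attach P.parts (fun lam =>
        (if 1 < lam.card then (if lam ∈ (P.bind p).parts then 0 else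
            g lam ((P.bind p).parts.filter (· ⊆ lam)).card) else 1 : ℂ)),
        ← Finset.prod_filter, stepWeight]
      split_ifs with h
      · refine Finset.prod_congr rfl fun lam hlam => ?_
        rw [Finset.mem_filter] at hlam
        rw [if_neg (h.2.2 lam hlam.1 hlam.2)]
      · have : ∃ lam ∈ P.parts, 1 < lam.card ∧ lam ∈ (P.bind p).parts := by
          by_contra! h'
          exact h ⟨bind_le P p, hP, h'⟩
        obtain ⟨lam, h1, h2, h3⟩ := this
        exact Finset.prod_eq_zero (Finset.mem_filter.mpr ⟨h1, h2⟩) (if_pos h3)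
    · rw [Finpartition.bind_parts, Finset.prod_biUnion]
      rintro ⟨b, hb⟩ - ⟨c, hc⟩ - hbc
      rw [Function.onFun, Finset.disjoint_left]
      intro d hdb hdc
      obtain ⟨i, hi⟩ := (p b hb).nonempty_of_mem_parts hdb
      exact hbc (Subtype.ext (P.eq_of_mem_parts hb hc ((p b hb).le hdb hi) ((p c hc).le hdc hi)))

/-- The sum of the weights of the step sequences of length `L` from `P` to the partition into
singletons. -/
noncomputable def pathSum (g : Finset (Fin N) → ℕ → ℂ) : ℕ → Ptn N → ℂ
  | 0, P => if P = ⊥ then 1 else 0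
  | L + 1, P => ∑ Q, stepWeight g P Q * pathSum g L Q

/-- Rewrites the sum over tuples of partitions, the form in which `SplittingChain.ptn` presents a
chain. -/
theorem pathSum_eq (g : Finset (Fin N) → ℕ → ℂ) (L : ℕ) (P : Ptn N) :
    pathSum g L P = ∑ p : Fin (L + 1) → Ptn N, if p 0 = P ∧ p (Fin.last L) = ⊥ then
      ∏ i : Fin L, stepWeight g (p i.castSucc) (p i.succ) else 0 := by
  induction L generalizing P with
  | zero =>
    rw [← (Equiv.funUnique (Fin 1) (Ptn N)).symm.sum_comp]
    have : ∀ Q : Ptn N, (if Q = P ∧ Q = ⊥ then (1 : ℂ) else 0) =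
        if Q = P then (if P = ⊥ then 1 else 0) else 0 := by
      intro Q
      by_cases h : Q = P
      · subst h; simp
      · simp [h]
    simp [pathSum, this]
  | succ L ih =>
    rw [← (Fin.consEquiv fun _ : Fin (L + 2) => Ptn N).sum_comp, Fintype.sum_prod_type]
    simp only [Fin.consEquiv, Equiv.coe_fn_mk, Fin.cons_zero]
    rw [Finset.sum_eq_single P]
    · simp only [pathSum, ih, Finset.mul_sum]
      rw [Finset.sum_comm]
      refine Finset.sum_congr rfl fun p _ => ?_
      rw [Finset.sum_eq_single (p 0)]
      · rw [← Fin.succ_last, Fin.cons_succ, Fin.prod_univ_succ]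
        simp only [Fin.castSucc_zero, Fin.cons_zero, Fin.cons_succ, true_and, mul_ite, mul_zero,
          ← Fin.succ_castSucc]
      · intro Q _ hQ
        rw [if_neg fun h => hQ h.1.symm, mul_zero]
      · simp
    · intro Q _ hQ
      simp [hQ]
    · simp

/-- Every step goes strictly down, so a path with `L` steps visits `L + 1` partitions below `P`;
lengths under `n` therefore miss no path. -/
theorem IsTreeSum.sum_pathSum {g : Finset (Fin N) → ℕ → ℂ} {T : Finset (Fin N) → ℂ}
    (hT : IsTreeSum g T) (n : ℕ) (P : Ptn N) (hP : Nat.card (Set.Iic P) ≤ n) :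
    ∑ L ∈ Finset.range n, pathSum g L P = ∏ lam ∈ P.parts, T lam := by
  induction n generalizing P with
  | zero =>
    have : 0 < Nat.card (Set.Iic P) := Nat.card_pos
    omega
  | succ n ih =>
    rw [Finset.sum_range_succ']
    by_cases hb : P = ⊥
    · subst hb
      -- Nothing leaves `⊥`, so only the path of length 0 contributes, and both sides are 1.
      have h0 : ∀ Q : Ptn N, stepWeight g ⊥ Q = 0 := fun Q => stepWeight_eq_zero not_lt_bot
      simp [pathSum, h0, hT.singleton]
    · simp only [pathSum, hb, if_false, add_zero]
      rw [Finset.sum_comm, hT.prod_parts hb]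
      refine Finset.sum_congr rfl fun Q _ => ?_
      rw [← Finset.mul_sum]
      by_cases hQ : Q < P
      · rw [ih]
        have : Nat.card (Set.Iic Q) < Nat.card (Set.Iic P) := by
          rw [Nat.card_coe_set_eq, Nat.card_coe_set_eq]
          exact Set.ncard_lt_ncard (Set.Iic_ssubset_Iic.mpr hQ) (Set.toFinite _)
        omega
      · rw [stepWeight_eq_zero hQ, zero_mul, zero_mul]

namespace SplittingChain

variable (c : SplittingChain N)

theorem ptn_last_eq : c.ptn (Fin.last c.length) = ⊥ := by
  apply Finpartition.ext
  rw [c.ptn_last]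
  ext b
  simp

theorem mem_parts_of_between {P Q R : Ptn N} (hQP : Q ≤ P) (hRQ : R ≤ Q) {lam : Finset (Fin N)}
    (hP : lam ∈ P.parts) (hR : lam ∈ R.parts) : lam ∈ Q.parts := by
  obtain ⟨b, hb, h1⟩ := hRQ hR
  obtain ⟨a, ha, h2⟩ := hQP hb
  have : lam = a := eq_of_subset_of_mem_parts hP ha (h1.trans h2)
  subst this
  rwa [le_antisymm h1 h2]

theorem mem_branches {lam : Finset (Fin N)} :
    lam ∈ c.branches ↔ (∃ l, lam ∈ (c.ptn l).parts) ∧ 1 < lam.card := by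
  simp [branches]

theorem depth_eq_of_unique {lam : Finset (Fin N)} {l : Fin (c.length + 1)}
    (hl : lam ∈ (c.ptn l).parts) (h : ∀ m, lam ∈ (c.ptn m).parts → m = l) : c.depth lam = l := by
  have : Finset.univ.filter (fun m : Fin (c.length + 1) => lam ∈ (c.ptn m).parts) = {l} := by
    ext m
    simp only [Finset.mem_filter, Finset.mem_univ, true_and, Finset.mem_singleton]
    exact ⟨h m, fun h => h ▸ hl⟩
  rw [depth, this, Finset.sup_singleton]

/-- Reducedness compares arbitrary levels, `IsStep` only adjacent ones. A part present at two levels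
is present at all levels between them, so a repeated branch is already repeated at the next level.
-/
theorem isReduced_iff :
    c.IsReduced ↔ ∀ i : Fin c.length, IsStep (c.ptn i.castSucc) (c.ptn i.succ) := by
  constructor
  · intro h i
    have hlt := c.strictAnti (Fin.castSucc_lt_succ (i := i))
    refine ⟨hlt.le, (bot_le.trans_lt hlt).ne', fun lam hlam hc hlam' => ?_⟩
    have hb : lam ∈ c.branches := c.mem_branches.mpr ⟨⟨_, hlam⟩, hc⟩
    have h1 := (h lam hb _).mp hlam
    have h2 := (h lam hb _).mp hlam'
    simp at h1 h2
    omega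
  · intro h lam hlam
    obtain ⟨⟨l, hl⟩, hc⟩ := c.mem_branches.mp hlam
    have hlt : ∀ a b : Fin (c.length + 1), lam ∈ (c.ptn a).parts → lam ∈ (c.ptn b).parts →
        ¬ a < b := by
      intro a b ha hb hab
      let i : Fin c.length := ⟨a, by omega⟩
      have hia : i.castSucc = a := rfl
      have hib : i.succ ≤ b := by
        rw [Fin.le_def]
        exact hab
      have hstep := h i
      rw [hia] at hstep
      exact hstep.2.2 lam ha hc
        (mem_parts_of_between hstep.1 (c.strictAnti.antitone hib) ha hb)
    have huniq : ∀ m, lam ∈ (c.ptn m).parts → m = l := fun m hm =>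
      le_antisymm (not_lt.mp (hlt _ _ hl hm)) (not_lt.mp (hlt _ _ hm hl))
    have hd := c.depth_eq_of_unique hl huniq
    intro m
    rw [hd]
    refine ⟨fun hm => by rw [huniq m hm], fun hm => ?_⟩
    rwa [Fin.ext hm]

/-- In a reduced chain a branch lives at one level only, its depth. The branches are thus the
disjoint union, over all levels but the last, of the non-singleton parts, and degrees are counted in
the next partition. -/
theorem prod_branches (hc : c.IsReduced) (g : Finset (Fin N) → ℕ → ℂ) :
    ∏ lam ∈ c.branches, g lam (c.deg lam) =
      ∏ i : Fin c.length, stepWeight g (c.ptn i.castSucc) (c.ptn i.succ) := by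
  classical
  have hstep := c.isReduced_iff.mp hc
  have hdepth : ∀ (i : Fin c.length), ∀ lam ∈ (c.ptn i.castSucc).parts, 1 < lam.card →
      (i : ℕ) = c.depth lam := by
    intro i lam hlam h1
    exact (hc lam (c.mem_branches.mpr ⟨⟨_, hlam⟩, h1⟩) _).mp hlam
  have hbr : c.branches = Finset.univ.biUnion fun i : Fin c.length =>
      (c.ptn i.castSucc).parts.filter (1 < ·.card) := by
    ext lam
    rw [c.mem_branches]
    simp only [Finset.mem_biUnion, Finset.mem_univ, true_and, Finset.mem_filter]
    constructor
    · rintro ⟨⟨l, hl⟩, h1⟩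
      induction l using Fin.lastCases with
      | last =>
        rw [c.ptn_last_eq, Finpartition.mem_bot_iff] at hl
        obtain ⟨a, -, rfl⟩ := hl
        simp at h1
      | cast i => exact ⟨i, hl, h1⟩
    · rintro ⟨i, hi, h1⟩
      exact ⟨⟨_, hi⟩, h1⟩
  rw [hbr, Finset.prod_biUnion]
  · refine Finset.prod_congr rfl fun i _ => ?_
    rw [stepWeight, if_pos (hstep i)]
    refine Finset.prod_congr rfl fun lam hlam => ?_
    rw [Finset.mem_filter] at hlam
    congr 1
    rw [deg, ← hdepth i lam hlam.1 hlam.2]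
    congr 1
    ext b
    simp only [Finset.mem_filter, Finset.mem_univ, true_and]
    constructor
    · rintro ⟨h1, l, hl, h2⟩
      have : l = i.succ := Fin.ext hl
      subst this
      exact ⟨h2, h1⟩
    · rintro ⟨h2, h1⟩
      exact ⟨h1, i.succ, rfl, h2⟩
  · intro i _ j _ hij
    rw [Function.onFun, Finset.disjoint_left]
    intro lam hi hj
    rw [Finset.mem_filter] at hi hj
    exact hij (Fin.ext ((hdepth i lam hi.1 hi.2).trans (hdepth j lam hj.1 hj.2).symm))

end SplittingChain

theorem IsTreeSum.sum_reducedChain (hN : 2 ≤ N) {g : Finset (Fin N) → ℕ → ℂ}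
    {T : Finset (Fin N) → ℂ} (hT : IsTreeSum g T) :
    ∑ c : ReducedChain N, ∏ lam ∈ c.1.branches, g lam (c.1.deg lam) = T Finset.univ := by
  classical
  have hne : (Finset.univ : Finset (Fin N)) ≠ ⊥ := by
    have : Nonempty (Fin N) := ⟨⟨0, by omega⟩⟩
    exact Finset.univ_nonempty.ne_empty
  let P₀ : Ptn N := Finpartition.indiscrete hne
  have hP₀ : P₀.parts = {Finset.univ} := rfl
  have h := hT.sum_pathSum (Fintype.card (Ptn N)) P₀ (by
    rw [Nat.card_coe_set_eq, ← Nat.card_eq_fintype_card]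
    exact Set.ncard_le_card _)
  rw [hP₀, Finset.prod_singleton] at h
  rw [← h]
  simp only [pathSum_eq]
  rw [Finset.sum_sigma']
  -- A tuple of nonzero weight consists of `IsStep`s, hence is strictly decreasing and reduced, so
  -- it is a reduced chain. Tuples of weight 0 need no partner.
  refine Finset.sum_bij_ne_zero
    (fun c _ _ => (⟨c.1.length, c.1.ptn⟩ : Σ L : ℕ, Fin (L + 1) → Ptn N)) ?_ ?_ ?_ ?_
  · intro c _ _
    simp [c.1.length_le]
  · rintro ⟨⟨L, h1, p, h2, h3, h4⟩, hc⟩ _ _ ⟨⟨L', h1', p', h2', h3', h4'⟩, hc'⟩ _ _ h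
    simp only [Sigma.mk.injEq] at h
    obtain ⟨rfl, h⟩ := h
    simp only [heq_eq_eq] at h
    subst h
    rfl
  · rintro ⟨L, p⟩ _ hp
    dsimp only at hp
    have hp' : p 0 = P₀ ∧ p (Fin.last L) = ⊥ := by
      by_contra hcon
      exact hp (if_neg hcon)
    rw [if_pos hp', Finset.prod_ne_zero_iff] at hp
    have hstep : ∀ i : Fin L, IsStep (p i.castSucc) (p i.succ) := by
      intro i
      by_contra hcon
      exact hp i (Finset.mem_univ i) (if_neg hcon)
    -- Length 0 would make the one-part partition equal to `⊥`, which is impossible for `N ≥ 2`.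
    have hL : 1 ≤ L := by
      rcases Nat.eq_zero_or_pos L with rfl | h
      · exfalso
        have h1 : P₀ = ⊥ := hp'.1.symm.trans hp'.2
        have h2 : P₀.parts.card = (⊥ : Ptn N).parts.card := by rw [h1]
        rw [hP₀, Finpartition.card_bot] at h2
        simp at h2
        omega
      · exact h
    let c : SplittingChain N :=
      { length := L
        length_pos := hL
        ptn := p
        strictAnti := Fin.strictAnti_iff_succ_lt.mpr fun i => (hstep i).lt
        ptn_first := by rw [hp'.1, hP₀]
        ptn_last := by
          rw [hp'.2]
          ext b
          simp }
    have hc : c.IsReduced := c.isReduced_iff.mpr hstep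
    refine ⟨⟨c, hc⟩, Finset.mem_univ _, ?_, rfl⟩
    rw [c.prod_branches hc]
    exact Finset.prod_ne_zero_iff.mpr hp
  · intro c _ _
    rw [c.1.prod_branches c.2, if_pos]
    exact ⟨Finpartition.ext (c.1.ptn_first.trans hP₀.symm), c.1.ptn_last_eq⟩

end Combinatorics

/-! ### Distributions of indices among labels, grouped by their fibre partition. -/

section Fibers

variable {ι B : Type*} [DecidableEq ι] [DecidableEq B]

/-- The partition of `S` into the nonempty fibers of `f`. -/
def fiberPartition (S : Finset ι) (f : ι → B) : Finpartition S :=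
  Finpartition.ofSetSetoid (Setoid.comap f ⊥) S

theorem parts_fiberPartition (S : Finset ι) (f : ι → B) :
    (fiberPartition S f).parts = (S.image f).image fun b => S.filter (f · = b) := by
  ext lam
  simp only [fiberPartition, Finpartition.ofSetSetoid, Finset.mem_image, exists_exists_and_eq_and]
  refine exists_congr fun a => and_congr_right fun ha => ?_
  rw [← Finset.filter_congr (p := fun i => f i = f a)]
  intro i _
  exact eq_comm

theorem fiberPartition_eq_iff {S : Finset ι} {f : ι → B} {P : Finpartition S} :
    fiberPartition S f = P ↔ ∀ i ∈ S, ∀ j ∈ S, f i = f j ↔ P.part i = P.part j := by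
  have hpart : ∀ (Q : Finpartition S) {i j}, i ∈ S → j ∈ S → (Q.part i = Q.part j ↔ j ∈ Q.part i) := by
    intro Q i j hi hj
    rw [eq_comm, Q.mem_part_iff_part_eq_part hj hi]
  have hf : ∀ i ∈ S, ∀ j ∈ S, f i = f j ↔ (fiberPartition S f).part i = (fiberPartition S f).part j := by
    intro i hi j hj
    rw [hpart _ hi hj, fiberPartition, Finpartition.mem_part_ofSetSetoid_iff_rel]
    constructor
    · exact fun h => ⟨hi, hj, h⟩
    · exact fun h => h.2.2
  constructor
  · rintro rfl
    exact hf
  · intro h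
    have hparts : ∀ Q : Finpartition S, Q.parts = S.image Q.part := by
      intro Q
      ext b
      rw [Finset.mem_image]
      constructor
      · intro hb
        obtain ⟨i, hi⟩ := Q.nonempty_of_mem_parts hb
        exact ⟨i, Q.le hb hi, Q.part_eq_of_mem hb hi⟩
      · rintro ⟨i, hi, rfl⟩
        exact Q.part_mem.mpr hi
    have key : ∀ i ∈ S, (fiberPartition S f).part i = P.part i := by
      intro i hi
      ext j
      by_cases hj : j ∈ S
      · rw [← hpart _ hi hj, ← hf i hi j hj, h i hi j hj, hpart _ hi hj]
      · exact iff_of_false (fun h => hj (Finpartition.part_subset _ i h))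
          (fun h => hj (Finpartition.part_subset _ i h))
    apply Finpartition.ext
    rw [hparts, hparts]
    exact Finset.image_congr key

theorem prod_fibers [Fintype B] {R : Type*} [CommMonoid R] (S : Finset ι) (f : ι → B)
    (H : Finset ι → R) (h0 : H ∅ = 1) :
    ∏ b, H (S.filter (f · = b)) = ∏ lam ∈ (fiberPartition S f).parts, H lam := by
  rw [parts_fiberPartition, Finset.prod_image]
  · symm
    refine Finset.prod_subset (Finset.subset_univ _) fun b _ hb => ?_
    rw [Finset.filter_eq_empty_iff.mpr, h0]
    intro i hi h
    exact hb (Finset.mem_image.mpr ⟨i, hi, h⟩)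
  · intro b hb c hc hbc
    obtain ⟨i, hi, rfl⟩ := Finset.mem_image.mp hb
    have : i ∈ S.filter (f · = c) := by
      have h' : S.filter (f · = f i) = S.filter (f · = c) := hbc
      rw [← h']
      exact Finset.mem_filter.mpr ⟨hi, rfl⟩
    exact (Finset.mem_filter.mp this).2

/-- Such a map amounts to an injection of the parts of `P` into `B` together with arbitrary values
off `S`. -/
theorem card_fiberPartition_eq [Fintype ι] [Fintype B] {S : Finset ι} (P : Finpartition S) :
    (Finset.univ.filter fun f : ι → B => fiberPartition S f = P).card =
      Fintype.card B ^ (Fintype.card ι - S.card) * (Fintype.card B).descFactorial P.parts.card := by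
  have hcard : Fintype.card ((P.parts ↪ B) × ({i // i ∉ S} → B)) =
      Fintype.card B ^ (Fintype.card ι - S.card) * (Fintype.card B).descFactorial P.parts.card := by
    rw [Fintype.card_prod, Fintype.card_embedding_eq, Fintype.card_fun, mul_comm]
    congr 2
    · rw [Fintype.card_subtype_compl, Fintype.card_coe]
    · rw [Fintype.card_coe]
  rw [← hcard, ← Finset.card_univ, eq_comm]
  have hmem : ∀ i ∈ S, P.part i ∈ P.parts := fun i hi => P.part_mem.mpr hi
  refine Finset.card_bij (fun x _ i => if hi : i ∈ S then x.1 ⟨P.part i, hmem i hi⟩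
    else x.2 ⟨i, hi⟩) ?_ ?_ ?_
  · intro x _
    rw [Finset.mem_filter, fiberPartition_eq_iff]
    refine ⟨Finset.mem_univ _, fun i hi j hj => ?_⟩
    rw [dif_pos hi, dif_pos hj, x.1.injective.eq_iff, Subtype.mk.injEq]
  · rintro ⟨e, h⟩ _ ⟨e', h'⟩ _ heq
    have heq' := congrFun heq
    refine Prod.ext (DFunLike.ext _ _ ?_) (funext ?_)
    · rintro ⟨lam, hlam⟩
      obtain ⟨i, hi⟩ := P.nonempty_of_mem_parts hlam
      have hiS : i ∈ S := P.le hlam hi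
      have := heq' i
      simpa [hiS, P.part_eq_of_mem hlam hi] using this
    · rintro ⟨i, hi⟩
      simpa [hi] using heq' i
  · intro f hf
    rw [Finset.mem_filter, fiberPartition_eq_iff] at hf
    have hex : ∀ lam : P.parts, ∃ i, i ∈ lam.1 := fun lam => P.nonempty_of_mem_parts lam.2
    choose r hr using hex
    have hrS : ∀ lam, r lam ∈ S := fun lam => P.le lam.2 (hr lam)
    have hrp : ∀ lam, P.part (r lam) = lam := fun lam => P.part_eq_of_mem lam.2 (hr lam)
    refine ⟨⟨⟨fun lam => f (r lam), ?_⟩, fun i => f i⟩, Finset.mem_univ _, ?_⟩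
    · intro a b hab
      have := (hf.2 _ (hrS a) _ (hrS b)).mp hab
      rw [hrp, hrp] at this
      exact Subtype.ext this
    · funext i
      by_cases hi : i ∈ S
      · simp only [hi, dif_pos]
        exact (hf.2 _ (hrS _) _ hi).mpr (hrp _)
      · simp [hi]

/-- Sums over functions of products over their fibers, as sums over partitions. -/
theorem sum_prod_fibers [Fintype ι] [Fintype B] {R : Type*} [CommSemiring R] (S : Finset ι)
    (H : Finset ι → R) (h0 : H ∅ = 1) :
    ∑ f : ι → B, ∏ b, H (S.filter (f · = b)) =
      (Fintype.card B : R) ^ (Fintype.card ι - S.card) * ∑ P : Finpartition S,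
        ((Fintype.card B).descFactorial P.parts.card : R) * ∏ lam ∈ P.parts, H lam := by
  rw [← Finset.sum_fiberwise Finset.univ (fiberPartition S), Finset.mul_sum]
  refine Finset.sum_congr rfl fun P _ => ?_
  rw [Finset.sum_congr rfl (g := fun _ => ∏ lam ∈ P.parts, H lam)]
  · rw [Finset.sum_const, card_fiberPartition_eq, nsmul_eq_mul]
    push_cast
    ring
  · intro f hf
    rw [prod_fibers S f H h0, (Finset.mem_filter.mp hf).2]

end Fibers

/-! ### Integrals over a space tiled by rescaled copies of another space. -/

noncomputable section Cover

open scoped ENNReal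

theorem enorm_finset_prod {ι : Type*} (t : Finset ι) (F : ι → ℂ) :
    ‖∏ i ∈ t, F i‖ₑ = ∏ i ∈ t, ‖F i‖ₑ := by
  classical
  induction t using Finset.induction_on with
  | empty => simp
  | insert a t ha ih => rw [Finset.prod_insert ha, Finset.prod_insert ha, enorm_mul, ih]

section PairProd

variable {X : Type*} {N : ℕ} (s : Fin N → Fin N → ℂ)

/-- The product of `d (x i) (x j) ^ s i j` over the pairs `i < j` in `S`. -/
def pairProd (d : X → X → ℝ) (S : Finset (Fin N)) (x : Fin N → X) : ℂ :=
  ∏ i ∈ S, ∏ j ∈ S with i < j, ((d (x i) (x j) : ℝ) : ℂ) ^ s i j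

/-- The factor by which `pairProd` changes when all distances are divided by `q`. -/
def pairScale (q : ℕ) (S : Finset (Fin N)) : ℂ :=
  ∏ i ∈ S, ∏ j ∈ S with i < j, (((q : ℝ)⁻¹ : ℝ) : ℂ) ^ s i j

theorem pairProd_empty (d : X → X → ℝ) (x : Fin N → X) : pairProd s d ∅ x = 1 := by
  simp [pairProd]

theorem measurable_pairProd [MeasurableSpace X] {d : X → X → ℝ} (hd : Measurable fun p : X × X => d p.1 p.2)
    (S : Finset (Fin N)) : Measurable (pairProd s d S) := by
  unfold pairProd
  refine Finset.measurable_prod _ fun i _ => Finset.measurable_prod _ fun j _ => ?_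
  refine Measurable.pow_const (Complex.measurable_ofReal.comp ?_) _
  exact hd.comp (g := fun p : X × X => d p.1 p.2) (f := fun x : Fin N → X => (x i, x j))
    ((measurable_pi_apply i).prodMk (measurable_pi_apply j))

theorem dependsOn_pairProd (d : X → X → ℝ) (S : Finset (Fin N)) :
    DependsOn (pairProd s d S) S := by
  intro x y h
  unfold pairProd
  refine Finset.prod_congr rfl fun i hi => Finset.prod_congr rfl fun j hj => ?_
  rw [h i hi, h j (Finset.mem_filter.mp hj).1]

theorem prod_pairs_fibers {B : Type*} [Fintype B] [DecidableEq B] {M : Type*} [CommMonoid M]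
    (S : Finset (Fin N)) (f : Fin N → B) (F : Fin N → Fin N → M)
    (hF : ∀ i j, f i ≠ f j → F i j = 1) :
    ∏ i ∈ S, ∏ j ∈ S with i < j, F i j =
      ∏ b, ∏ i ∈ S.filter (f · = b), ∏ j ∈ S.filter (f · = b) with i < j, F i j := by
  rw [← Finset.prod_fiberwise S f]
  refine Finset.prod_congr rfl fun b _ => Finset.prod_congr rfl fun i hi => ?_
  symm
  refine Finset.prod_subset (Finset.filter_subset_filter _ (Finset.filter_subset _ _)) ?_
  intro j hj hj'
  refine hF i j fun h => hj' ?_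
  simp only [Finset.mem_filter] at hi hj ⊢
  exact ⟨⟨hj.1, h ▸ hi.2⟩, hj.2⟩

end PairProd

variable {X Y B : Type*} [MeasurableSpace X] [MeasurableSpace Y] {N : ℕ}

/-- Each function factors through the restriction to its own coordinates, the others being filled in
with a fixed point `x₀`. Independence of disjoint blocks of coordinates then carries over. -/
theorem indepFun_of_dependsOn {ι : Type*} [Fintype ι] {μ : Measure X}
    [IsProbabilityMeasure μ] {E F : Type*} [MeasurableSpace E] [MeasurableSpace F]
    {G : (ι → X) → E} {H : (ι → X) → F}
    (hG : Measurable G) (hH : Measurable H) {S T : Finset ι} (hGS : DependsOn G S)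
    (hHT : DependsOn H T) (hST : Disjoint S T) :
    ProbabilityTheory.IndepFun G H (Measure.pi fun _ : ι => μ) := by
  classical
  obtain ⟨x₀⟩ : Nonempty X := nonempty_of_isProbabilityMeasure μ
  have hi : ProbabilityTheory.iIndepFun (fun i (x : ι → X) => x i) (Measure.pi fun _ : ι => μ) :=
    ProbabilityTheory.iIndepFun_pi (X := fun _ : ι => (id : X → X)) fun _ => aemeasurable_id
  have hext : ∀ U : Finset ι, Measurable fun (y : U → X) (i : ι) => if h : i ∈ U then y ⟨i, h⟩ else x₀ := by
    intro U
    refine measurable_pi_lambda _ fun i => ?_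
    by_cases h : i ∈ U
    · simpa [h] using measurable_pi_apply _
    · simp [h]
  have h := (hi.indepFun_finset S T hST fun i => measurable_pi_apply i).comp
    (hG.comp (hext S)) (hH.comp (hext T))
  convert! h using 1
  · funext x
    refine hGS fun i hi => ?_
    have : i ∈ S := hi
    simp [this]
  · funext x
    refine hHT fun i hi => ?_
    have : i ∈ T := hi
    simp [this]

section Product

variable {ι : Type*} [Fintype ι] [DecidableEq B] {μ : Measure X}
    [IsProbabilityMeasure μ] {t : Finset B} {b : B} {S : Finset ι} {f : ι → B}

theorem indepFun_prod_fibers {M : Type*} [CommMonoid M] [MeasurableSpace M] [MeasurableMul₂ M]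
    {F : B → (ι → X) → M} (hF : ∀ b, Measurable (F b))
    (hdep : ∀ b, DependsOn (F b) (S.filter (f · = b))) (hb : b ∉ t) :
    ProbabilityTheory.IndepFun (F b) (fun x => ∏ c ∈ t, F c x) (Measure.pi fun _ : ι => μ) := by
  refine indepFun_of_dependsOn (T := S.filter (f · ∈ t)) (hF b)
    (Finset.measurable_prod _ fun c _ => hF c) (hdep b) ?_ ?_
  · intro x y h
    refine Finset.prod_congr rfl fun c hc => hdep c fun i hi => h i ?_
    simp only [Finset.coe_filter, Set.mem_ofPred_eq] at hi ⊢
    exact ⟨hi.1, hi.2 ▸ hc⟩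
  · rw [Finset.disjoint_left]
    intro i hi hi'
    rw [Finset.mem_filter] at hi hi'
    exact hb (hi.2 ▸ hi'.2)

/-- Distinct fibres involve disjoint sets of coordinates. For independent functions the product rule
holds without integrability, so measurability suffices. -/
theorem integral_prod_fibers {F : B → (ι → X) → ℂ} (hF : ∀ b, Measurable (F b))
    (hdep : ∀ b, DependsOn (F b) (S.filter (f · = b))) (t : Finset B) :
    ∫ x, ∏ b ∈ t, F b x ∂(Measure.pi fun _ : ι => μ) =
      ∏ b ∈ t, ∫ x, F b x ∂(Measure.pi fun _ : ι => μ) := by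
  induction t using Finset.cons_induction with
  | empty => simp
  | cons b t hb ih =>
    simp only [Finset.prod_cons]
    rw [(indepFun_prod_fibers hF hdep hb).integral_fun_mul_eq_mul_integral
      (hF b).aestronglyMeasurable
      (Finset.measurable_prod _ fun c _ => hF c).aestronglyMeasurable, ih]

theorem lintegral_prod_fibers {F : B → (ι → X) → ℝ≥0∞} (hF : ∀ b, Measurable (F b))
    (hdep : ∀ b, DependsOn (F b) (S.filter (f · = b))) (t : Finset B) :
    ∫⁻ x, ∏ b ∈ t, F b x ∂(Measure.pi fun _ : ι => μ) =
      ∏ b ∈ t, ∫⁻ x, F b x ∂(Measure.pi fun _ : ι => μ) := by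
  induction t using Finset.cons_induction with
  | empty => simp
  | cons b t hb ih =>
    simp only [Finset.prod_cons]
    rw [ProbabilityTheory.lintegral_mul_eq_lintegral_mul_lintegral_of_indepFun'' (hF b).aemeasurable
      (Finset.measurable_prod _ fun c _ => hF c).aemeasurable (indepFun_prod_fibers hF hdep hb), ih]

end Product

/-- `Y` is the disjoint union of copies of `X`, indexed by `B` and of equal measure, in each of
which the distances are those of `X` divided by `q`, points in distinct copies being at
distance `1`. -/
structure IsCover [Fintype B] (q : ℕ) (μ : Measure X) (d : X → X → ℝ) (ν : Measure Y)
    (δ : Y → Y → ℝ) (ψ : B → X → Y) : Prop where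
  measurable : ∀ b, Measurable (ψ b)
  sum_map : ν = ∑ b, (Fintype.card B : ℝ≥0∞)⁻¹ • μ.map (ψ b)
  dist_same : ∀ b x y, δ (ψ b x) (ψ b y) = (q : ℝ)⁻¹ * d x y
  dist_ne : ∀ b c x y, b ≠ c → δ (ψ b x) (ψ c y) = 1

namespace IsCover

variable [Fintype B] {q : ℕ} {μ : Measure X} {d : X → X → ℝ} {ν : Measure Y} {δ : Y → Y → ℝ}
  {ψ : B → X → Y} (s : Fin N → Fin N → ℂ)

theorem pairProd_eq [DecidableEq B] (h : IsCover q μ d ν δ ψ) (hd : ∀ x y, 0 ≤ d x y)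
    (S : Finset (Fin N)) (f : Fin N → B) (x : Fin N → X) :
    pairProd s δ S (fun i => ψ (f i) (x i)) =
      ∏ b, pairScale s q (S.filter (f · = b)) * pairProd s d (S.filter (f · = b)) x := by
  unfold pairProd pairScale
  rw [prod_pairs_fibers S f]
  · refine Finset.prod_congr rfl fun b _ => ?_
    rw [← Finset.prod_mul_distrib]
    refine Finset.prod_congr rfl fun i hi => ?_
    rw [← Finset.prod_mul_distrib]
    refine Finset.prod_congr rfl fun j hj => ?_
    simp only [Finset.mem_filter] at hi hj
    dsimp only
    -- The complex power of the product splits because both bases are nonnegative reals.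
    rw [hi.2, hj.1.2, h.dist_same, Complex.ofReal_mul,
      Complex.mul_cpow_ofReal_nonneg (by positivity) (hd _ _)]
  · intro i j hij
    dsimp only
    rw [h.dist_ne _ _ _ _ hij, Complex.ofReal_one, Complex.one_cpow]

theorem measurable_comp (h : IsCover q μ d ν δ ψ) (f : Fin N → B) :
    Measurable fun (x : Fin N → X) i => ψ (f i) (x i) :=
  measurable_pi_lambda _ fun i => (h.measurable (f i)).comp (measurable_pi_apply i)

/-- On boxes, expanding the product of the sums given by `sum_map` yields one term for each
assignment `f` of the points to the copies. -/
theorem pi_eq [DecidableEq B] [IsProbabilityMeasure μ] [IsProbabilityMeasure ν]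
    (h : IsCover q μ d ν δ ψ) :
    (Measure.pi fun _ : Fin N => ν) = ∑ f : Fin N → B, ((Fintype.card B : ℝ≥0∞)⁻¹ ^ N) •
      (Measure.pi fun _ : Fin N => μ).map fun x i => ψ (f i) (x i) := by
  refine Measure.pi_eq fun t ht => ?_
  have h1 : ∀ i, ν (t i) = ∑ b, (Fintype.card B : ℝ≥0∞)⁻¹ * μ (ψ b ⁻¹' t i) := by
    intro i
    conv_lhs => rw [h.sum_map]
    simp [Measure.finsetSum_apply, Measure.map_apply (h.measurable _) (ht i)]
  simp only [h1]
  rw [Finset.prod_univ_sum, Fintype.piFinset_univ, Measure.finsetSum_apply]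
  refine Finset.sum_congr rfl fun f _ => ?_
  rw [Measure.smul_apply, Measure.map_apply (h.measurable_comp f) (.univ_pi ht),
    Finset.prod_mul_distrib]
  simp only [Finset.prod_const, Finset.card_univ, Fintype.card_fin, smul_eq_mul]
  rw [← Measure.pi_pi]
  rfl

/-- For a fixed assignment the integrand is a product over the copies, each factor involving only
the points assigned to it, so the integral factors by independence. -/
theorem lintegral_pairProd [DecidableEq B] [IsProbabilityMeasure μ] [IsProbabilityMeasure ν]
    (h : IsCover q μ d ν δ ψ) (hd : ∀ x y, 0 ≤ d x y)
    (hdm : Measurable fun p : X × X => d p.1 p.2) (hδm : Measurable fun p : Y × Y => δ p.1 p.2)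
    (S : Finset (Fin N)) :
    ∫⁻ y, ‖pairProd s δ S y‖ₑ ∂(Measure.pi fun _ : Fin N => ν) =
      (Fintype.card B : ℝ≥0∞)⁻¹ ^ N * ∑ f : Fin N → B, ∏ b, ‖pairScale s q (S.filter (f · = b))‖ₑ *
        ∫⁻ x, ‖pairProd s d (S.filter (f · = b)) x‖ₑ ∂(Measure.pi fun _ : Fin N => μ) := by
  rw [h.pi_eq, lintegral_finsetSum_measure, Finset.mul_sum]
  refine Finset.sum_congr rfl fun f _ => ?_
  rw [lintegral_smul_measure, lintegral_map (measurable_pairProd s hδm S).enorm (h.measurable_comp f),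
    smul_eq_mul]
  congr 1
  simp only [h.pairProd_eq s hd, enorm_finset_prod, enorm_mul]
  rw [lintegral_prod_fibers (S := S) (f := f)
    (F := fun b x => ‖pairScale s q (S.filter (f · = b))‖ₑ * ‖pairProd s d (S.filter (f · = b)) x‖ₑ)]
  · refine Finset.prod_congr rfl fun b _ => ?_
    rw [lintegral_const_mul _ (measurable_pairProd s hdm _).enorm]
  · exact fun b => (measurable_pairProd s hdm _).enorm.const_mul _
  · intro b x y hxy
    simp only
    rw [dependsOn_pairProd s d _ hxy]

theorem integral_pairProd [DecidableEq B] [IsProbabilityMeasure μ] [IsProbabilityMeasure ν]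
    (h : IsCover q μ d ν δ ψ) (hd : ∀ x y, 0 ≤ d x y)
    (hdm : Measurable fun p : X × X => d p.1 p.2) (hδm : Measurable fun p : Y × Y => δ p.1 p.2)
    (S : Finset (Fin N))
    (hint : Integrable (pairProd s δ S) (Measure.pi fun _ : Fin N => ν)) :
    ∫ y, pairProd s δ S y ∂(Measure.pi fun _ : Fin N => ν) =
      (Fintype.card B : ℂ)⁻¹ ^ N * ∑ f : Fin N → B, ∏ b, pairScale s q (S.filter (f · = b)) *
        ∫ x, pairProd s d (S.filter (f · = b)) x ∂(Measure.pi fun _ : Fin N => μ) := by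
  rw [h.pi_eq] at hint ⊢
  rw [integrable_finsetSum_measure] at hint
  rw [integral_finsetSum_measure hint, Finset.mul_sum]
  refine Finset.sum_congr rfl fun f _ => ?_
  rw [integral_smul_measure, integral_map (h.measurable_comp f).aemeasurable
    (measurable_pairProd s hδm S).aestronglyMeasurable]
  simp only [h.pairProd_eq s hd]
  rw [integral_prod_fibers (S := S) (f := f)
    (F := fun b x => pairScale s q (S.filter (f · = b)) * pairProd s d (S.filter (f · = b)) x)]
  · simp [integral_const_mul]
  · exact fun b => (measurable_pairProd s hdm _).const_mul _
  · intro b x y hxy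
    simp only
    rw [dependsOn_pairProd s d _ hxy]

end IsCover

end Cover

/-! ### Finiteness and divergence of the norm integral over a self-similar space. -/

noncomputable section SelfSimilar

open scoped ENNReal
open Filter Topology

variable {N : ℕ} (s : Fin N → Fin N → ℂ)

/-- The origin of the exponent `expo s S`: the one-block partition contributes `q · q ^ (-#S) ·
pairScale s q S`, which is `q ^ (-expo s S)`. -/
theorem cpow_expo_mul_pairScale {q : ℕ} (hq : 2 ≤ q) (S : Finset (Fin N)) :
    (q : ℂ) ^ expo s S * pairScale s q S = (q : ℂ) ^ S.card / q := by
  have hq0 : (q : ℂ) ≠ 0 := Nat.cast_ne_zero.mpr (by omega)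
  have h1 : ∀ z : ℂ, (((q : ℝ)⁻¹ : ℝ) : ℂ) ^ z = Complex.exp (Complex.log q * -z) := by
    intro z
    rw [Complex.ofReal_inv, Complex.ofReal_natCast, Complex.inv_cpow, ← Complex.cpow_neg,
      Complex.cpow_def_of_ne_zero hq0]
    rw [Complex.natCast_arg]
    exact Real.pi_pos.ne
  have h2 : pairScale s q S = (q : ℂ) ^ (-∑ i ∈ S, ∑ j ∈ S with i < j, s i j) := by
    unfold pairScale
    simp only [h1]
    rw [Complex.cpow_def_of_ne_zero hq0]
    simp only [← Complex.exp_sum, ← Finset.mul_sum, Finset.sum_neg_distrib]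
  rw [h2, ← Complex.cpow_add _ _ hq0, expo]
  have : (S.card : ℂ) - 1 + ∑ i ∈ S, ∑ j ∈ S with i < j, s i j +
      -∑ i ∈ S, ∑ j ∈ S with i < j, s i j = (S.card : ℂ) - 1 := by ring
  rw [this, Complex.cpow_sub _ _ hq0, Complex.cpow_one, Complex.cpow_natCast]

theorem one_lt_norm_cpow_iff {q : ℕ} (hq : 2 ≤ q) (z : ℂ) : 1 < ‖(q : ℂ) ^ z‖ ↔ 0 < z.re := by
  rw [Complex.norm_natCast_cpow_of_pos (by omega)]
  exact Real.one_lt_rpow_iff_of_pos (by positivity) |>.trans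
    ⟨fun h => h.elim (fun h => h.2) fun h => by
      have : (2 : ℝ) ≤ q := by exact_mod_cast hq
      linarith [h.1], fun h => Or.inl ⟨by exact_mod_cast hq, h⟩⟩

theorem pairScale_ne_zero {q : ℕ} (hq : 2 ≤ q) (S : Finset (Fin N)) : pairScale s q S ≠ 0 := by
  intro h
  have h1 := cpow_expo_mul_pairScale s hq S
  have hq0 : (q : ℂ) ≠ 0 := Nat.cast_ne_zero.mpr (by omega)
  rw [h, mul_zero, eq_comm, div_eq_zero_iff] at h1
  simp [hq0] at h1

theorem pairScale_empty (q : ℕ) : pairScale s q ∅ = 1 := by simp [pairScale]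

theorem filter_lt_eq_empty {S : Finset (Fin N)} (hS : S.card ≤ 1) {i : Fin N} (hi : i ∈ S) :
    S.filter (i < ·) = ∅ := by
  refine Finset.filter_eq_empty_iff.mpr fun j hj => ?_
  rw [Finset.card_le_one.mp hS i hi j hj]
  exact lt_irrefl j

theorem pairProd_of_card_le_one {X : Type*} (d : X → X → ℝ) {S : Finset (Fin N)}
    (hS : S.card ≤ 1) (x : Fin N → X) : pairProd s d S x = 1 :=
  Finset.prod_eq_one fun i hi => by rw [filter_lt_eq_empty hS hi, Finset.prod_empty]

theorem pairScale_of_card_le_one (q : ℕ) {S : Finset (Fin N)} (hS : S.card ≤ 1) :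
    pairScale s q S = 1 :=
  Finset.prod_eq_one fun i hi => by rw [filter_lt_eq_empty hS hi, Finset.prod_empty]

theorem mem_parts_fiberPartition_self {ι B : Type*} [DecidableEq ι] [DecidableEq B] {S : Finset ι}
    {f : ι → B} (h : S ∈ (fiberPartition S f).parts) : ∀ i ∈ S, ∀ j ∈ S, f i = f j := by
  rw [parts_fiberPartition, Finset.mem_image] at h
  obtain ⟨b, -, hb⟩ := h
  intro i hi j hj
  rw [← hb] at hi hj
  rw [(Finset.mem_filter.mp hi).2, (Finset.mem_filter.mp hj).2]

/-- Isolates the one-block partition, the only term of the recursion in which the value at `S`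
itself reappears. -/
theorem sum_finpartition_eq_add {M : Type*} [AddCommMonoid M] {S : Finset (Fin N)}
    (hS : S.Nonempty) (F : Finset (Finset (Fin N)) → M) :
    ∑ P : Finpartition S, F P.parts =
      F {S} + ∑ P : Finpartition S, if S ∈ P.parts then 0 else F P.parts := by
  classical
  have hT : ∀ P : Finpartition S, S ∈ P.parts ↔ P = Finpartition.indiscrete hS.ne_empty := by
    intro P
    constructor
    · intro h
      apply Finpartition.ext
      refine Finset.eq_singleton_iff_unique_mem.mpr ⟨h, fun b hb => ?_⟩
      exact eq_of_subset_of_mem_parts hb h (P.le hb)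
    · rintro rfl
      exact Finset.mem_singleton_self S
  simp only [hT]
  rw [← Finset.add_sum_erase _ _ (Finset.mem_univ (Finpartition.indiscrete hS.ne_empty))]
  congr 1
  rw [← Finset.add_sum_erase _ (fun P : Finpartition S =>
    if P = Finpartition.indiscrete hS.ne_empty then 0 else F P.parts)
    (Finset.mem_univ (Finpartition.indiscrete hS.ne_empty)), if_pos rfl, zero_add]
  exact Finset.sum_congr rfl fun P hP => (if_neg (Finset.ne_of_mem_erase hP)).symm

/-- The distance `d`, truncated from below. -/
def truncDist {X : Type*} (q : ℕ) (d : X → X → ℝ) (n : ℕ) (x y : X) : ℝ := max (d x y) ((q : ℝ)⁻¹ ^ n)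

theorem truncDist_nonneg {X : Type*} {q : ℕ} {d : X → X → ℝ} (n : ℕ) (x y : X) : 0 ≤ truncDist q d n x y :=
  le_max_of_le_right (by positivity)

variable {X Y B A : Type*} [MeasurableSpace X] [MeasurableSpace Y] [Fintype B] [Fintype A]

/-- The integral of the norm of `pairProd`. -/
def normIntegral (μ : Measure X) (d : X → X → ℝ) (S : Finset (Fin N)) : ℝ≥0∞ :=
  ∫⁻ x, ‖pairProd s d S x‖ₑ ∂(Measure.pi fun _ : Fin N => μ)

theorem normIntegral_of_card_le_one (μ : Measure X) [IsProbabilityMeasure μ] (d : X → X → ℝ)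
    {S : Finset (Fin N)} (hS : S.card ≤ 1) : normIntegral s μ d S = 1 := by
  simp [normIntegral, pairProd_of_card_le_one s d hS]

namespace IsCover

variable {q : ℕ} {μ : Measure X} {d : X → X → ℝ} {ν : Measure Y} {δ : Y → Y → ℝ}
  {ψ : B → X → Y} [IsProbabilityMeasure μ] [IsProbabilityMeasure ν]

theorem normIntegral_eq [Nonempty B] (h : IsCover q μ d ν δ ψ) (hd : ∀ x y, 0 ≤ d x y)
    (hdm : Measurable fun p : X × X => d p.1 p.2) (hδm : Measurable fun p : Y × Y => δ p.1 p.2)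
    (S : Finset (Fin N)) :
    normIntegral s ν δ S = (Fintype.card B : ℝ≥0∞)⁻¹ ^ S.card * ∑ P : Finpartition S,
      ((Fintype.card B).descFactorial P.parts.card : ℝ≥0∞) *
        ∏ lam ∈ P.parts, ‖pairScale s q lam‖ₑ * normIntegral s μ d lam := by
  have : DecidableEq B := Classical.decEq B
  unfold normIntegral
  rw [h.lintegral_pairProd s hd hdm hδm S, sum_prod_fibers S (fun lam => ‖pairScale s q lam‖ₑ *
    ∫⁻ x, ‖pairProd s d lam x‖ₑ ∂(Measure.pi fun _ : Fin N => μ)), ← mul_assoc]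
  · congr 1
    -- The labels of the `N - #S` indices outside `S` are free; their number cancels against part of
    -- the normalisation, leaving the exponent `#S`.
    have hS : S.card ≤ N := by simpa using Finset.card_le_univ S
    have hB : (Fintype.card B : ℝ≥0∞) ≠ 0 := Nat.cast_ne_zero.mpr Fintype.card_ne_zero
    rw [Fintype.card_fin]
    obtain ⟨k, hk⟩ := Nat.exists_eq_add_of_le hS
    generalize S.card = c at hk ⊢
    rw [hk, Nat.add_sub_cancel_left, pow_add, mul_assoc, ← mul_pow,
      ENNReal.inv_mul_cancel hB (ENNReal.natCast_ne_top _), one_pow, mul_one]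
  · simp [pairScale_empty, pairProd_empty]

theorem integral_eq [Nonempty B] (h : IsCover q μ d ν δ ψ) (hd : ∀ x y, 0 ≤ d x y)
    (hdm : Measurable fun p : X × X => d p.1 p.2) (hδm : Measurable fun p : Y × Y => δ p.1 p.2)
    (S : Finset (Fin N)) (hint : Integrable (pairProd s δ S) (Measure.pi fun _ : Fin N => ν)) :
    ∫ y, pairProd s δ S y ∂(Measure.pi fun _ : Fin N => ν) =
      (Fintype.card B : ℂ)⁻¹ ^ S.card * ∑ P : Finpartition S,
      ((Fintype.card B).descFactorial P.parts.card : ℂ) *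
        ∏ lam ∈ P.parts, pairScale s q lam *
          ∫ x, pairProd s d lam x ∂(Measure.pi fun _ : Fin N => μ) := by
  have : DecidableEq B := Classical.decEq B
  rw [h.integral_pairProd s hd hdm hδm S hint, sum_prod_fibers S (fun lam => pairScale s q lam *
    ∫ x, pairProd s d lam x ∂(Measure.pi fun _ : Fin N => μ)), ← mul_assoc]
  · congr 1
    have hS : S.card ≤ N := by simpa using Finset.card_le_univ S
    have hB : (Fintype.card B : ℂ) ≠ 0 := Nat.cast_ne_zero.mpr Fintype.card_ne_zero
    rw [Fintype.card_fin]
    obtain ⟨k, hk⟩ := Nat.exists_eq_add_of_le hS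
    generalize S.card = c at hk ⊢
    rw [hk, Nat.add_sub_cancel_left, pow_add, mul_assoc, ← mul_pow, inv_mul_cancel₀ hB, one_pow,
      mul_one]
  · simp [pairScale_empty, pairProd_empty]

/-- The contribution of the nontrivial partitions to `normIntegral`. -/
def properSum (s : Fin N → Fin N → ℂ) (q m : ℕ) (I : Finset (Fin N) → ℝ≥0∞) (S : Finset (Fin N)) :
    ℝ≥0∞ :=
  (m : ℝ≥0∞)⁻¹ ^ S.card * ∑ P : Finpartition S, if S ∈ P.parts then 0 else
    (m.descFactorial P.parts.card : ℝ≥0∞) * ∏ lam ∈ P.parts, ‖pairScale s q lam‖ₑ * I lam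

theorem normIntegral_eq_add (hq : 2 ≤ q) (h : IsCover q μ d ν δ ψ) (hB : Fintype.card B = q)
    (hd : ∀ x y, 0 ≤ d x y)
    (hdm : Measurable fun p : X × X => d p.1 p.2) (hδm : Measurable fun p : Y × Y => δ p.1 p.2)
    {S : Finset (Fin N)} (hS : S.Nonempty) :
    normIntegral s ν δ S = ‖(q : ℂ) ^ expo s S‖ₑ⁻¹ * normIntegral s μ d S +
      properSum s q q (normIntegral s μ d) S := by
  have : Nonempty B := Fintype.card_pos_iff.mp (by omega)
  rw [h.normIntegral_eq s hd hdm hδm S, hB, sum_finpartition_eq_add hS (fun p =>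
    (q.descFactorial p.card : ℝ≥0∞) * ∏ lam ∈ p, ‖pairScale s q lam‖ₑ * normIntegral s μ d lam),
    mul_add, properSum]
  congr 1
  simp only [Finset.card_singleton, Nat.descFactorial_one, Finset.prod_singleton, ← mul_assoc]
  congr 1
  have h1 := congrArg enorm (cpow_expo_mul_pairScale s hq S)
  have hq0 : (q : ℂ) ≠ 0 := Nat.cast_ne_zero.mpr (by omega)
  have hc0 : (q : ℂ) ^ expo s S ≠ 0 := by simp [Complex.cpow_eq_zero_iff, hq0]
  have hq1 : ‖(q : ℂ)‖ₑ = q := by simp [enorm_eq_nnnorm]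
  rw [enorm_mul, div_eq_mul_inv, enorm_mul, enorm_pow, enorm_inv hq0, hq1] at h1
  have hqe : (q : ℝ≥0∞) ≠ 0 := Nat.cast_ne_zero.mpr (by omega)
  refine ENNReal.eq_inv_of_mul_eq_one_left ?_
  rw [mul_assoc, mul_comm ‖pairScale s q S‖ₑ, h1, mul_comm ((q : ℝ≥0∞) ^ S.card), ← mul_assoc,
    mul_assoc _ (q : ℝ≥0∞), ENNReal.mul_inv_cancel hqe (ENNReal.natCast_ne_top _), mul_one, ← mul_pow,
    ENNReal.inv_mul_cancel hqe (ENNReal.natCast_ne_top _), one_pow]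

end IsCover

variable {q : ℕ} {μ : Measure X} {d : X → X → ℝ} {φ : A → X → X}

/-- Dividing distances by `q` turns the cut-off `q⁻¹ ^ n` into `q⁻¹ ^ (n + 1)`, so self-similarity
becomes a recursion in `n`. -/
theorem IsCover.truncDist (hq : 2 ≤ q) (h : IsCover q μ d μ d φ) (n : ℕ) :
    IsCover q μ (truncDist q d n) μ (truncDist q d (n + 1)) φ where
  measurable := h.measurable
  sum_map := h.sum_map
  dist_same a x y := by
    rw [LogCoulomb.truncDist, LogCoulomb.truncDist, h.dist_same, mul_max_of_nonneg _ _ (by positivity),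
      pow_succ']
  dist_ne a b x y hab := by
    rw [LogCoulomb.truncDist, h.dist_ne a b x y hab]
    refine max_eq_left (pow_le_one₀ (by positivity) (inv_le_one_of_one_le₀ ?_))
    exact_mod_cast (by omega : 1 ≤ q)

theorem measurable_truncDist (hdm : Measurable fun p : X × X => d p.1 p.2) (n : ℕ) :
    Measurable fun p : X × X => truncDist q d n p.1 p.2 :=
  hdm.max measurable_const

theorem properSum_mono {m : ℕ} {I J : Finset (Fin N) → ℝ≥0∞} {S : Finset (Fin N)}
    (h : ∀ lam ⊂ S, I lam ≤ J lam) :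
    IsCover.properSum s q m I S ≤ IsCover.properSum s q m J S := by
  unfold IsCover.properSum
  gcongr with P _
  split_ifs with hP
  · exact le_rfl
  · gcongr with lam hlam
    refine h lam ((P.le hlam).lt_of_ne ?_)
    rintro rfl
    exact hP hlam

theorem properSum_ne_top {m : ℕ} (hm : m ≠ 0) {I : Finset (Fin N) → ℝ≥0∞} {S : Finset (Fin N)}
    (h : ∀ lam ⊂ S, I lam ≠ ⊤) : IsCover.properSum s q m I S ≠ ⊤ := by
  unfold IsCover.properSum
  have hm' : (m : ℝ≥0∞) ≠ 0 := Nat.cast_ne_zero.mpr hm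
  refine ENNReal.mul_ne_top (ENNReal.pow_ne_top (ENNReal.inv_ne_top.mpr hm')) ?_
  refine ENNReal.sum_ne_top.mpr fun P _ => ?_
  split_ifs with hP
  · exact ENNReal.zero_ne_top
  · refine ENNReal.mul_ne_top (ENNReal.natCast_ne_top _) (ENNReal.prod_ne_top fun lam hlam => ?_)
    refine ENNReal.mul_ne_top enorm_ne_top (h lam ((P.le hlam).lt_of_ne ?_))
    rintro rfl
    exact hP hlam

theorem one_lt_enorm_cpow_iff (hq : 2 ≤ q) (z : ℂ) : 1 < ‖(q : ℂ) ^ z‖ₑ ↔ 0 < z.re := by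
  rw [← one_lt_norm_cpow_iff hq, ← ofReal_norm, ENNReal.one_lt_ofReal]

variable [IsProbabilityMeasure μ]

/-- By strong induction the proper subsets contribute at most a constant `b` independent of `n`. The
integrals `I n` then satisfy `I (n + 1) ≤ r * I n + b` with `r < 1`, and `I 0 = 1` because `d ≤ 1`;
hence `I n ≤ 1 + b / (1 - r)`. -/
theorem exists_normIntegral_truncDist_le (hq : 2 ≤ q) (h : IsCover q μ d μ d φ)
    (hA : Fintype.card A = q) (hd1 : ∀ x y, d x y ≤ 1)
    (hdm : Measurable fun p : X × X => d p.1 p.2) (hs : s ∈ Omega N) (S : Finset (Fin N)) :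
    ∃ C : ℝ≥0∞, C ≠ ⊤ ∧ ∀ n, normIntegral s μ (truncDist q d n) S ≤ C := by
  induction S using Finset.strongInduction with
  | H S ih =>
    rcases le_or_gt S.card 1 with hS | hS
    · exact ⟨1, ENNReal.one_ne_top, fun n => (normIntegral_of_card_le_one s μ _ hS).le⟩
    -- `properSum` takes a function on all finsets; its values off the proper subsets of `S` are
    -- immaterial.
    have hC : ∀ lam, ∃ C : ℝ≥0∞, lam ⊂ S → C ≠ ⊤ ∧
        ∀ n, normIntegral s μ (truncDist q d n) lam ≤ C := by
      intro lam
      by_cases hlam : lam ⊂ S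
      · obtain ⟨C, hC⟩ := ih lam hlam
        exact ⟨C, fun _ => hC⟩
      · exact ⟨0, fun h => absurd h hlam⟩
    choose C hC using hC
    set r : ℝ≥0∞ := ‖(q : ℂ) ^ expo s S‖ₑ⁻¹ with hr
    have hr1 : r < 1 := ENNReal.inv_lt_one.mpr ((one_lt_enorm_cpow_iff hq _).mpr (hs S hS))
    set b := IsCover.properSum s q q C S with hb
    have hb' : b ≠ ⊤ := properSum_ne_top s (by omega) fun lam hlam => (hC lam hlam).1
    have hr0 : 1 - r ≠ 0 := (tsub_pos_of_lt hr1).ne'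
    have hrt : 1 - r ≠ ⊤ := (tsub_le_self.trans_lt ENNReal.one_lt_top).ne
    set k := (1 - r)⁻¹ with hk
    have hk' : r * k + 1 = k := by
      have : (r + (1 - r)) * k = k := by rw [add_tsub_cancel_of_le hr1.le, one_mul]
      rwa [add_mul, hk, ENNReal.mul_inv_cancel hr0 hrt] at this
    refine ⟨1 + b * k, ENNReal.add_ne_top.mpr ⟨ENNReal.one_ne_top,
      ENNReal.mul_ne_top hb' (ENNReal.inv_ne_top.mpr hr0)⟩, fun n => ?_⟩
    induction n with
    | zero =>
      have h1 : ∀ x y, truncDist q d 0 x y = 1 := fun x y => by simp [truncDist, hd1]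
      have h2 : normIntegral s μ (truncDist q d 0) S = 1 := by
        simp [normIntegral, pairProd, h1]
      rw [h2]
      exact le_self_add
    | succ n ihn =>
      rw [(h.truncDist hq n).normIntegral_eq_add s hq hA (truncDist_nonneg n)
        (measurable_truncDist hdm n) (measurable_truncDist hdm (n + 1))
        (Finset.card_pos.mp (by omega))]
      calc _ ≤ r * (1 + b * k) + b := by
            refine add_le_add (mul_le_mul_right ihn r) ?_
            exact properSum_mono s fun lam hlam => (hC lam hlam).2 n
        _ = r + b * (r * k + 1) := by ring
        _ ≤ 1 + b * k := by
            rw [hk']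
            gcongr

/-- The coincidence set `Z` is self-similar: it pulls back to itself when `i` and `j` go to the same
copy and to `∅` otherwise. Its measure thus equals `c / q ^ N` times itself, where `c < q ^ N`
counts the assignments with `f i = f j`, and so vanishes. -/
theorem ae_dist_pos (hq : 2 ≤ q) (h : IsCover q μ d μ d φ)
    (hA : Fintype.card A = q) (hd : ∀ x y, 0 ≤ d x y)
    (hdm : Measurable fun p : X × X => d p.1 p.2) {i j : Fin N} (hij : i ≠ j) :
    ∀ᵐ x ∂(Measure.pi fun _ : Fin N => μ), 0 < d (x i) (x j) := by
  classical
  set M : Measure (Fin N → X) := Measure.pi fun _ : Fin N => μ with hM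
  set Z : Set (Fin N → X) := {x | d (x i) (x j) = 0} with hZ
  have hZm : MeasurableSet Z := by
    have : Measurable fun x : Fin N → X => d (x i) (x j) :=
      hdm.comp (g := fun p : X × X => d p.1 p.2) (f := fun x : Fin N → X => (x i, x j))
        ((measurable_pi_apply i).prodMk (measurable_pi_apply j))
    exact this (measurableSet_singleton 0)
  have hq0 : (q : ℝ) ≠ 0 := Nat.cast_ne_zero.mpr (by omega)
  have hpre : ∀ f : Fin N → A, (fun (x : Fin N → X) k => φ (f k) (x k)) ⁻¹' Z =
      if f i = f j then Z else ∅ := by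
    intro f
    ext x
    split_ifs with hf
    · simp only [hZ, Set.mem_preimage, Set.mem_ofPred_eq]
      rw [hf, h.dist_same]
      simp [hq0]
    · simp only [hZ, Set.mem_preimage, Set.mem_ofPred_eq, Set.mem_empty_iff_false, iff_false]
      rw [h.dist_ne _ _ _ _ hf]
      exact one_ne_zero
  have key : M Z = ∑ f : Fin N → A, if f i = f j then (q : ℝ≥0∞)⁻¹ ^ N * M Z else 0 := by
    conv_lhs => rw [hM, h.pi_eq]
    rw [Measure.finsetSum_apply]
    refine Finset.sum_congr rfl fun f _ => ?_
    rw [Measure.smul_apply, Measure.map_apply (h.measurable_comp f) hZm, hpre, hA]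
    split_ifs <;> simp [hM]
  rw [← Finset.sum_filter, Finset.sum_const, nsmul_eq_mul] at key
  set c := (Finset.univ.filter fun f : Fin N → A => f i = f j).card with hc
  have hcq : c < q ^ N := by
    have : q ^ N = (Finset.univ : Finset (Fin N → A)).card := by
      simp [hA]
    rw [this, hc]
    refine Finset.card_lt_card (Finset.filter_ssubset.mpr ?_)
    have : Nontrivial A := Fintype.one_lt_card_iff_nontrivial.mp (by omega)
    obtain ⟨a, b, hab⟩ := exists_pair_ne A
    exact ⟨fun k => if k = i then a else b, Finset.mem_univ _, by simpa [hij.symm] using hab⟩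
  have hM0 : M Z = 0 := by
    have h1 := congrArg ENNReal.toReal key
    simp only [ENNReal.toReal_mul, ENNReal.toReal_natCast, ENNReal.toReal_pow, ENNReal.toReal_inv] at h1
    have h2 : (M Z).toReal * ((q : ℝ) ^ N - c) = 0 := by
      have hqN : (q : ℝ) ^ N ≠ 0 := pow_ne_zero _ hq0
      have h3 : (M Z).toReal * (q : ℝ) ^ N = c * (M Z).toReal := by
        conv_lhs => rw [h1]
        rw [inv_pow]
        field_simp
      linarith
    have h3 : (q : ℝ) ^ N - c ≠ 0 := by
      have : (c : ℝ) < (q : ℝ) ^ N := by exact_mod_cast hcq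
      linarith
    exact (ENNReal.toReal_eq_zero_iff _).mp ((mul_eq_zero.mp h2).resolve_right h3)
      |>.resolve_right (measure_ne_top _ _)
  have : ∀ᵐ x ∂M, x ∉ Z := measure_eq_zero_iff_ae_notMem.mp hM0
  filter_upwards [this] with x hx
  exact lt_of_le_of_ne (hd _ _) (Ne.symm hx)

theorem ae_forall_dist_pos (hq : 2 ≤ q) (h : IsCover q μ d μ d φ)
    (hA : Fintype.card A = q) (hd : ∀ x y, 0 ≤ d x y)
    (hdm : Measurable fun p : X × X => d p.1 p.2) :
    ∀ᵐ x ∂(Measure.pi fun _ : Fin N => μ), ∀ i j, i ≠ j → 0 < d (x i) (x j) := by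
  rw [ae_all_iff]
  intro i
  rw [ae_all_iff]
  intro j
  by_cases hij : i = j
  · simp [hij]
  · filter_upwards [ae_dist_pos hq h hA hd hdm hij] with x hx _
    exact hx

theorem normIntegral_ne_zero (hq : 2 ≤ q) (h : IsCover q μ d μ d φ)
    (hA : Fintype.card A = q) (hd : ∀ x y, 0 ≤ d x y)
    (hdm : Measurable fun p : X × X => d p.1 p.2) (S : Finset (Fin N)) :
    normIntegral s μ d S ≠ 0 := by
  intro h0
  rw [normIntegral, lintegral_eq_zero_iff (measurable_pairProd s hdm S).enorm] at h0
  have : ∀ᵐ x ∂(Measure.pi fun _ : Fin N => μ), False := by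
    filter_upwards [h0, ae_forall_dist_pos hq h hA hd hdm] with x hx hx'
    simp only [Pi.zero_apply, enorm_eq_zero] at hx
    refine Finset.prod_ne_zero_iff.mpr (fun i _ => Finset.prod_ne_zero_iff.mpr fun j hj => ?_) hx
    have := hx' i j (Finset.mem_filter.mp hj).2.ne
    rw [Complex.cpow_ne_zero_iff]
    exact Or.inl (Complex.ofReal_ne_zero.mpr this.ne')
  exact this.exists.elim fun _ h => h

/-- Off the null set of coincidences the truncated integrands are eventually constant in `n`, so
Fatou's lemma carries the uniform bound over. Monotone convergence is unavailable, the real parts of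
the exponents having either sign. -/
theorem normIntegral_ne_top (hq : 2 ≤ q) (h : IsCover q μ d μ d φ)
    (hA : Fintype.card A = q) (hd : ∀ x y, 0 ≤ d x y) (hd1 : ∀ x y, d x y ≤ 1)
    (hdm : Measurable fun p : X × X => d p.1 p.2) (hs : s ∈ Omega N) (S : Finset (Fin N)) :
    normIntegral s μ d S ≠ ⊤ := by
  obtain ⟨C, hC, hle⟩ := exists_normIntegral_truncDist_le s hq h hA hd1 hdm hs S
  refine ne_top_of_le_ne_top hC ?_
  have hlim : Tendsto (fun n : ℕ => (q : ℝ)⁻¹ ^ n) atTop (𝓝 0) := by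
    refine tendsto_pow_atTop_nhds_zero_of_lt_one (by positivity) (inv_lt_one_of_one_lt₀ ?_)
    exact_mod_cast (by omega : 1 < q)
  have hae : ∀ᵐ x ∂(Measure.pi fun _ : Fin N => μ), ‖pairProd s d S x‖ₑ =
      liminf (fun n => ‖pairProd s (truncDist q d n) S x‖ₑ) atTop := by
    filter_upwards [ae_forall_dist_pos hq h hA hd hdm] with x hx
    have hev : ∀ᶠ n in atTop, ∀ i j, i ≠ j → truncDist q d n (x i) (x j) = d (x i) (x j) := by
      rw [eventually_all]
      intro i
      rw [eventually_all]
      intro j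
      by_cases hij : i = j
      · simp [hij]
      · filter_upwards [hlim.eventually_lt_const (hx i j hij)] with n hn _
        exact max_eq_left hn.le
    have hev' : (fun n => ‖pairProd s (truncDist q d n) S x‖ₑ) =ᶠ[atTop]
        fun _ => ‖pairProd s d S x‖ₑ := by
      filter_upwards [hev] with n hn
      congr 1
      refine Finset.prod_congr rfl fun i _ => Finset.prod_congr rfl fun j hj => ?_
      rw [hn i j (Finset.mem_filter.mp hj).2.ne]
    rw [liminf_congr hev', liminf_const]
  rw [normIntegral, lintegral_congr_ae hae]
  refine (lintegral_liminf_le fun n =>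
    (measurable_pairProd s (measurable_truncDist hdm n) S).enorm).trans ?_
  refine (liminf_le_liminf (Eventually.of_forall hle)).trans ?_
  rw [liminf_const]

/-- A finite value `I` would satisfy `I = r * I + properSum` with `r ≥ 1`, forcing the sum over
proper partitions to vanish. A partition of `S` into two blocks gives a nonzero term, since `q ≥ 2`.
-/
theorem normIntegral_eq_top (hq : 2 ≤ q) (h : IsCover q μ d μ d φ)
    (hA : Fintype.card A = q) (hd : ∀ x y, 0 ≤ d x y)
    (hdm : Measurable fun p : X × X => d p.1 p.2) {S : Finset (Fin N)} (hS : 1 < S.card)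
    (hs : (expo s S).re ≤ 0) : normIntegral s μ d S = ⊤ := by
  classical
  have hne : S.Nonempty := Finset.card_pos.mp (by omega)
  by_contra htop
  have heq := h.normIntegral_eq_add s hq hA hd hdm hdm hne
  have hr : 1 ≤ ‖(q : ℂ) ^ expo s S‖ₑ⁻¹ := by
    rw [ENNReal.one_le_inv, ← not_lt, one_lt_enorm_cpow_iff hq]
    exact not_lt.mpr hs
  have hle : normIntegral s μ d S + IsCover.properSum s q q (normIntegral s μ d) S ≤
      normIntegral s μ d S + 0 := by
    rw [add_zero]
    conv_rhs => rw [heq]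
    gcongr
    exact le_mul_of_one_le_left (by simp) hr
  have h0 : IsCover.properSum s q q (normIntegral s μ d) S = 0 :=
    le_zero_iff.mp ((ENNReal.add_le_add_iff_left htop).mp hle)
  obtain ⟨i, hi, j, hj, hij⟩ := Finset.one_lt_card.mp hS
  have : Nontrivial A := Fintype.one_lt_card_iff_nontrivial.mp (by omega)
  obtain ⟨a, b, hab⟩ := exists_pair_ne A
  set P := fiberPartition S fun k => if k = i then a else b with hP
  have hSP : S ∉ P.parts := by
    intro hSP
    have := mem_parts_fiberPartition_self hSP i hi j hj
    simp [hij.symm, hab] at this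
  -- Keeps the falling factorial in the term of `P` from vanishing.
  have hcard : P.parts.card ≤ q := by
    rw [hP, parts_fiberPartition, ← hA]
    exact Finset.card_image_le.trans (Finset.card_le_univ _)
  unfold IsCover.properSum at h0
  rw [mul_eq_zero, Finset.sum_eq_zero_iff] at h0
  rcases h0 with h0 | h0
  · exact pow_ne_zero _ (ENNReal.inv_ne_zero.mpr (ENNReal.natCast_ne_top q)) h0
  · have h1 := h0 P (Finset.mem_univ P)
    rw [if_neg hSP, mul_eq_zero, Finset.prod_eq_zero_iff] at h1
    rcases h1 with h1 | ⟨lam, -, h1⟩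
    · rw [Nat.cast_eq_zero, Nat.descFactorial_eq_zero_iff_lt] at h1
      omega
    · rw [mul_eq_zero, enorm_eq_zero] at h1
      exact h1.elim (pairScale_ne_zero s hq lam) (normIntegral_ne_zero s hq h hA hd hdm lam)

end SelfSimilar

/-! ### The integral as a tree sum. -/

noncomputable section TreeFormula

open scoped ENNReal

theorem descFactorial_eq_fall (q k : ℕ) : (q.descFactorial (k + 1) : ℂ) = q * fall q k := by
  have h := descPochhammer_eval_eq_descFactorial ℤ q (k + 1)
  rw [descPochhammer_succ_left, eval_mul, eval_comp] at h
  simp only [eval_X, eval_sub, eval_one] at h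
  rw [fall, ← Int.cast_natCast (q.descFactorial (k + 1)), ← h]
  push_cast
  rfl

variable {N : ℕ} (s : Fin N → Fin N → ℂ) {X Y A B : Type*} [MeasurableSpace X] [MeasurableSpace Y]
  [Fintype A] [Fintype B] {q : ℕ} {μ : Measure X} {d : X → X → ℝ} {φ : A → X → X}
  {ν : Measure Y} {δ : Y → Y → ℝ} {ψ : B → X → Y}

theorem integrable_pairProd_iff (hdm : Measurable fun p : X × X => d p.1 p.2) (S : Finset (Fin N)) :
    Integrable (pairProd s d S) (Measure.pi fun _ : Fin N => μ) ↔ normIntegral s μ d S ≠ ⊤ := by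
  rw [Integrable, and_iff_right (measurable_pairProd s hdm S).aestronglyMeasurable,
    hasFiniteIntegral_iff_enorm, lt_top_iff_ne_top]
  rfl

theorem two_le_card_parts {S : Finset (Fin N)} (hS : S.Nonempty) {P : Finpartition S}
    (hP : S ∉ P.parts) : 2 ≤ P.parts.card := by
  by_contra hlt
  have h1 : P.parts.card = 1 := by
    have := Finset.card_pos.mpr (P.parts_nonempty hS.ne_empty)
    omega
  obtain ⟨b, hb⟩ := Finset.card_eq_one.mp h1
  have hbi := P.biUnion_parts
  rw [hb, Finset.singleton_biUnion, id] at hbi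
  exact hP (by rw [hb, hbi]; simp)

variable [IsProbabilityMeasure μ] [IsProbabilityMeasure ν]

/-- If `lam` violates the condition, put its points into one disc and all others into a second one.
This assignment contributes an infinite factor times nonzero factors. Conversely, the integral is a
finite sum of finite products of finite terms. -/
theorem integrable_pairProd_univ_iff (hq : 2 ≤ q) (h : IsCover q μ d μ d φ)
    (hA : Fintype.card A = q) (hd : ∀ x y, 0 ≤ d x y) (hd1 : ∀ x y, d x y ≤ 1)
    (hdm : Measurable fun p : X × X => d p.1 p.2) (h' : IsCover q μ d ν δ ψ)
    (hB : Fintype.card B = q + 1) (hδm : Measurable fun p : Y × Y => δ p.1 p.2) :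
    Integrable (pairProd s δ Finset.univ) (Measure.pi fun _ : Fin N => ν) ↔ s ∈ Omega N := by
  classical
  rw [integrable_pairProd_iff s hδm]
  have hBt : (Fintype.card B : ℝ≥0∞) ≠ 0 := Nat.cast_ne_zero.mpr (by omega)
  constructor
  · intro hfin lam hlam
    by_contra hre
    apply hfin
    have htop := normIntegral_eq_top s hq h hA hd hdm hlam (not_lt.mp hre)
    rw [normIntegral, h'.lintegral_pairProd s hd hdm hδm]
    refine ENNReal.mul_eq_top.mpr (Or.inl ⟨pow_ne_zero _ (ENNReal.inv_ne_zero.mpr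
      (ENNReal.natCast_ne_top _)), ENNReal.sum_eq_top.mpr ?_⟩)
    have : Nontrivial B := Fintype.one_lt_card_iff_nontrivial.mp (by omega)
    obtain ⟨a, b, hab⟩ := exists_pair_ne B
    refine ⟨fun i => if i ∈ lam then a else b, Finset.mem_univ _, ?_⟩
    rw [← Finset.mul_prod_erase _ _ (Finset.mem_univ a)]
    have hfib : (Finset.univ.filter fun i => (if i ∈ lam then a else b) = a) = lam := by
      ext i
      by_cases hi : i ∈ lam <;> simp [hi, hab.symm]
    refine ENNReal.mul_eq_top.mpr (Or.inr ⟨?_, ?_⟩)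
    · rw [hfib]
      exact ENNReal.mul_eq_top.mpr (Or.inl ⟨enorm_ne_zero.mpr (pairScale_ne_zero s hq lam), htop⟩)
    · exact Finset.prod_ne_zero_iff.mpr fun c _ => mul_ne_zero
        (enorm_ne_zero.mpr (pairScale_ne_zero s hq _)) (normIntegral_ne_zero s hq h hA hd hdm _)
  · intro hs
    have : Nonempty B := Fintype.card_pos_iff.mp (by omega)
    rw [h'.normIntegral_eq s hd hdm hδm]
    refine ENNReal.mul_ne_top (ENNReal.pow_ne_top (ENNReal.inv_ne_top.mpr hBt)) ?_
    refine ENNReal.sum_ne_top.mpr fun P _ => ENNReal.mul_ne_top (ENNReal.natCast_ne_top _)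
      (ENNReal.prod_ne_top fun lam _ => ENNReal.mul_ne_top enorm_ne_top
        (normIntegral_ne_top s hq h hA hd hd1 hdm hs lam))

/-- The rescaled integral over `X` attached to a set of indices. -/
def treeValue (q : ℕ) (μ : Measure X) (d : X → X → ℝ) (S : Finset (Fin N)) : ℂ :=
  pairScale s q S * ∫ x, pairProd s d S x ∂(Measure.pi fun _ : Fin N => μ)

theorem treeValue_singleton (i : Fin N) : treeValue s q μ d {i} = 1 := by
  have h1 : ({i} : Finset (Fin N)).card ≤ 1 := by simp
  simp [treeValue, pairProd_of_card_le_one s d h1, pairScale_of_card_le_one s q h1]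

theorem cpow_expo_sub_one_ne_zero (hq : 2 ≤ q) (hs : s ∈ Omega N) {S : Finset (Fin N)}
    (hS : 1 < S.card) : (q : ℂ) ^ expo s S - 1 ≠ 0 := by
  intro h
  have h1 := (one_lt_norm_cpow_iff hq _).mpr (hs S hS)
  rw [sub_eq_zero.mp h] at h1
  simp at h1

/-- Multiplying the recursion for the integral by `q ^ expo s S * pairScale s q S = q ^ #S / q`
removes the normalisation and the factor `q` of every falling factorial. The one-block term is then
`treeValue` at `S` and moves to the left. -/
theorem treeValue_rec (hq : 2 ≤ q) (h : IsCover q μ d μ d φ)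
    (hA : Fintype.card A = q) (hd : ∀ x y, 0 ≤ d x y) (hd1 : ∀ x y, d x y ≤ 1)
    (hdm : Measurable fun p : X × X => d p.1 p.2) (hs : s ∈ Omega N) {S : Finset (Fin N)}
    (hS : 1 < S.card) :
    ((q : ℂ) ^ expo s S - 1) * treeValue s q μ d S = ∑ P : Finpartition S,
      if S ∈ P.parts then 0 else
        fall q (P.parts.card - 1) * ∏ lam ∈ P.parts, treeValue s q μ d lam := by
  have hq0 : (q : ℂ) ≠ 0 := Nat.cast_ne_zero.mpr (by omega)
  have hne : S.Nonempty := Finset.card_pos.mp (by omega)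
  have : Nonempty A := Fintype.card_pos_iff.mp (by omega)
  have h1 := h.integral_eq s hd hdm hdm S
    ((integrable_pairProd_iff s hdm S).mpr (normIntegral_ne_top s hq h hA hd hd1 hdm hs S))
  have h2 : ∀ P : Finpartition S, (q.descFactorial P.parts.card : ℂ) =
      q * fall q (P.parts.card - 1) := by
    intro P
    have : 0 < P.parts.card := Finset.card_pos.mpr (P.parts_nonempty hne.ne_empty)
    rw [← descFactorial_eq_fall, Nat.sub_add_cancel this]
  have htv : ∀ lam, pairScale s q lam *
      ∫ x, pairProd s d lam x ∂(Measure.pi fun _ : Fin N => μ) = treeValue s q μ d lam := fun _ => rfl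
  rw [hA] at h1
  simp only [h2, mul_assoc, htv] at h1
  rw [← Finset.mul_sum, sum_finpartition_eq_add hne (fun p =>
    fall q (p.card - 1) * ∏ lam ∈ p, treeValue s q μ d lam)] at h1
  simp only [Finset.card_singleton, Finset.prod_singleton] at h1
  have h3 : fall q (1 - 1) = 1 := by simp [fall]
  rw [h3, one_mul] at h1
  have h4 : (q : ℂ) ^ expo s S * treeValue s q μ d S = treeValue s q μ d S +
      ∑ P : Finpartition S, if S ∈ P.parts then 0 else
        fall q (P.parts.card - 1) * ∏ lam ∈ P.parts, treeValue s q μ d lam := by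
    conv_lhs => rw [treeValue, ← mul_assoc, cpow_expo_mul_pairScale s hq, h1]
    rw [inv_pow]
    field_simp
  rw [sub_mul, one_mul, h4]
  ring

/-- The branch weights of the tree formula, with the special weight at the root. -/
def treeWeight (q : ℕ) (lam : Finset (Fin N)) (k : ℕ) : ℂ :=
  if lam = Finset.univ then
    ((q : ℂ) ^ ((N : ℂ) + ∑ i, ∑ j with i < j, s i j) + 1 - k) *
      (fall q (k - 2) / ((q : ℂ) ^ expo s Finset.univ - 1))
  else fall q (k - 1) / ((q : ℂ) ^ expo s lam - 1)

theorem summand_eq_prod (hN : 2 ≤ N) (c : SplittingChain N) :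
    summand q s c = ∏ lam ∈ c.branches, treeWeight s q lam (c.deg lam) := by
  rw [← Finset.mul_prod_erase _ _ (univ_mem_branches hN c), summand, treeWeight, if_pos rfl,
    topNumerator]
  congr 1
  refine Finset.prod_congr rfl fun lam hlam => ?_
  rw [treeWeight, if_neg (Finset.ne_of_mem_erase hlam), branchFactor]

theorem integral_pairProd_univ (hN : 2 ≤ N) (hq : 2 ≤ q) (h : IsCover q μ d μ d φ)
    (hA : Fintype.card A = q) (hd : ∀ x y, 0 ≤ d x y) (hd1 : ∀ x y, d x y ≤ 1)
    (hdm : Measurable fun p : X × X => d p.1 p.2) (h' : IsCover q μ d ν δ ψ)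
    (hB : Fintype.card B = q + 1) (hδm : Measurable fun p : Y × Y => δ p.1 p.2)
    (hs : s ∈ Omega N) :
    ∫ y, pairProd s δ Finset.univ y ∂(Measure.pi fun _ : Fin N => ν) =
      1 / ((q : ℂ) + 1) ^ (N - 1) * ∑ c : ReducedChain N, summand q s c.1 := by
  classical
  have hq0 : (q : ℂ) ≠ 0 := Nat.cast_ne_zero.mpr (by omega)
  have hq1 : (q : ℂ) + 1 ≠ 0 := by exact_mod_cast (by omega : q + 1 ≠ 0)
  have hcard : 1 < (Finset.univ : Finset (Fin N)).card := by simp; omega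
  have hune : (Finset.univ : Finset (Fin N)).Nonempty := Finset.card_pos.mp (by omega)
  set Z := ∫ y, pairProd s δ Finset.univ y ∂(Measure.pi fun _ : Fin N => ν) with hZ
  have hsing : ∀ i : Fin N, ({i} : Finset (Fin N)) ≠ Finset.univ := by
    intro i hi
    rw [← hi] at hcard
    simp at hcard
  -- Proper subsets carry the integrals over `X`; the root carries the normalised integral over `Y`,
  -- whose first subdivision has `q + 1` pieces instead of `q`.
  have hT : IsTreeSum (treeWeight s q) fun lam => if lam = Finset.univ then
      ((q : ℂ) + 1) ^ (N - 1) * Z else treeValue s q μ d lam := by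
    constructor
    · intro i
      rw [if_neg (hsing i), treeValue_singleton]
    · intro S hS
      have hprod : ∀ P : Finpartition S, S ∉ P.parts →
          (∏ lam ∈ P.parts, if lam = Finset.univ then
            ((q : ℂ) + 1) ^ (N - 1) * Z else treeValue s q μ d lam) =
          ∏ lam ∈ P.parts, treeValue s q μ d lam := by
        intro P hP
        refine Finset.prod_congr rfl fun lam hlam => if_neg ?_
        rintro rfl
        have : S = Finset.univ := Finset.univ_subset_iff.mp (P.le hlam)
        exact hP (this ▸ hlam)
      have hrec := treeValue_rec s hq h hA hd hd1 hdm hs hS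
      have he := cpow_expo_sub_one_ne_zero s hq hs hS
      have hterm : ∀ P : Finpartition S, (if S ∈ P.parts then 0 else
          treeWeight s q S P.parts.card) * (∏ lam ∈ P.parts, if lam = Finset.univ then
            ((q : ℂ) + 1) ^ (N - 1) * Z else treeValue s q μ d lam) =
          if S ∈ P.parts then 0 else treeWeight s q S P.parts.card *
            ∏ lam ∈ P.parts, treeValue s q μ d lam := by
        intro P
        split_ifs with hP
        · rw [zero_mul]
        · rw [hprod P hP]
      simp only [hterm]
      split_ifs with hSu
      · subst hSu
        have : Nonempty B := Fintype.card_pos_iff.mp (by omega)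
        have hint := h'.integral_eq s hd hdm hδm Finset.univ
          ((integrable_pairProd_univ_iff s hq h hA hd hd1 hdm h' hB hδm).mpr hs)
        rw [← hZ, hB, Finset.card_univ, Fintype.card_fin] at hint
        rw [sum_finpartition_eq_add hune (fun p => ((q + 1).descFactorial p.card : ℂ) *
          ∏ lam ∈ p, pairScale s q lam *
            ∫ x, pairProd s d lam x ∂(Measure.pi fun _ : Fin N => μ))] at hint
        simp only [Finset.card_singleton, Finset.prod_singleton, Nat.descFactorial_one] at hint
        obtain ⟨n, rfl⟩ : ∃ n, N = n + 1 := ⟨N - 1, by omega⟩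
        have hexp : (q : ℂ) ^ (((n + 1 : ℕ) : ℂ) + ∑ i, ∑ j with i < j, s i j) =
            q * (q : ℂ) ^ expo s Finset.univ := by
          rw [expo, Finset.card_univ, Fintype.card_fin]
          rw [show (((n + 1 : ℕ) : ℂ) + ∑ i, ∑ j with i < j, s i j) = 1 + (((n + 1 : ℕ) : ℂ) - 1 +
            ∑ i, ∑ j with i < j, s i j) by ring, Complex.cpow_add _ _ hq0, Complex.cpow_one]
        have hdiv : treeValue s q μ d Finset.univ = (∑ P : Finpartition (Finset.univ : Finset (Fin (n + 1))),
            if Finset.univ ∈ P.parts then 0 else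
              fall q (P.parts.card - 1) * ∏ lam ∈ P.parts, treeValue s q μ d lam) /
                ((q : ℂ) ^ expo s Finset.univ - 1) := by
          rw [← hrec, mul_div_cancel_left₀ _ he]
        -- With `q + 1` pieces and `k ≥ 2` parts, the falling factorial is `(q + 1) * q * fall q (k
        -- - 2)`; the factor `q + 1` lowers the normalising exponent by one.
        have hZ' : ((q : ℂ) + 1) ^ (n + 1 - 1) * Z = treeValue s q μ d Finset.univ +
            ∑ P : Finpartition (Finset.univ : Finset (Fin (n + 1))),
            if Finset.univ ∈ P.parts then 0 else q * fall q (P.parts.card - 2) *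
              ∏ lam ∈ P.parts, treeValue s q μ d lam := by
          have hsum : (∑ P : Finpartition (Finset.univ : Finset (Fin (n + 1))),
              if Finset.univ ∈ P.parts then 0 else ((q + 1).descFactorial P.parts.card : ℂ) *
                ∏ lam ∈ P.parts, treeValue s q μ d lam) = ((q : ℂ) + 1) *
              ∑ P : Finpartition (Finset.univ : Finset (Fin (n + 1))),
              if Finset.univ ∈ P.parts then 0 else q * fall q (P.parts.card - 2) *
                ∏ lam ∈ P.parts, treeValue s q μ d lam := by
            rw [Finset.mul_sum]
            refine Finset.sum_congr rfl fun P _ => ?_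
            split_ifs with hP
            · rw [mul_zero]
            · have h2 : 2 ≤ P.parts.card := two_le_card_parts hune hP
              obtain ⟨k, hk⟩ := Nat.exists_eq_add_of_le h2
              rw [hk, show 2 + k = k + 1 + 1 by ring, Nat.succ_descFactorial_succ, Nat.cast_mul,
                descFactorial_eq_fall, show k + 1 + 1 - 2 = k by omega]
              push_cast
              ring
          have hint' : Z = ((q + 1 : ℕ) : ℂ)⁻¹ ^ (n + 1) * (((q + 1 : ℕ) : ℂ) * treeValue s q μ d Finset.univ +
            ((q : ℂ) + 1) *
              ∑ P : Finpartition (Finset.univ : Finset (Fin (n + 1))),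
              if Finset.univ ∈ P.parts then 0 else q * fall q (P.parts.card - 2) *
                ∏ lam ∈ P.parts, treeValue s q μ d lam) := by
            rw [← hsum]
            exact hint
          rw [hint', Nat.add_sub_cancel]
          push_cast
          rw [inv_pow, pow_succ]
          field_simp
        -- For `k` parts and `E = q ^ expo s univ`, the two contributions add up to `fall q (k - 2)
        -- * ((q + 1 - k) / (E - 1) + q)`. The numerator over `E - 1` is `q * E + 1 - k`, which
        -- gives the root weight.
        rw [hZ', hdiv, Finset.sum_div, ← Finset.sum_add_distrib]
        refine Finset.sum_congr rfl fun P _ => ?_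
        split_ifs with hP
        · simp
        · have h2 : 2 ≤ P.parts.card := two_le_card_parts hune hP
          rw [treeWeight, if_pos rfl, hexp, fall_factor h2]
          field_simp
          ring
      · have hdiv : treeValue s q μ d S = (∑ P : Finpartition S, if S ∈ P.parts then 0 else
            fall q (P.parts.card - 1) * ∏ lam ∈ P.parts, treeValue s q μ d lam) /
              ((q : ℂ) ^ expo s S - 1) := by
          rw [← hrec, mul_div_cancel_left₀ _ he]
        rw [hdiv, Finset.sum_div]
        refine Finset.sum_congr rfl fun P _ => ?_
        split_ifs with hP
        · rw [zero_div]
        · rw [treeWeight, if_neg hSu]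
          ring
  have hfinal := hT.sum_reducedChain hN
  rw [if_pos rfl] at hfinal
  simp only [summand_eq_prod s hN]
  rw [hfinal, ← mul_assoc, one_div, inv_mul_cancel₀ (pow_ne_zero _ hq1), one_mul]

end TreeFormula

/-! ### The canonical absolute value and the topology of K. -/

noncomputable section AbsoluteValue

open Filter Topology

variable (K : Type*) [Field K] [ValuativeRel K] [TopologicalSpace K] [IsNonarchimedeanLocalField K]

theorem two_le_resCard : 2 ≤ resCard K :=
  Finite.one_lt_card

variable {K}

theorem canonicalAbs_lt_iff {x y : K} : canonicalAbs K x < canonicalAbs K y ↔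
    ValuativeRel.valuation K x < ValuativeRel.valuation K y := by
  have h1 : (1 : ℝ≥0) < resCard K := by exact_mod_cast two_le_resCard K
  exact (WithZeroMulInt.toNNReal_strictMono h1).lt_iff_lt.trans
    (IsNonarchimedeanLocalField.valueGroupWithZeroIsoInt K).strictMono.lt_iff_lt

theorem canonicalAbs_le_iff {x y : K} : canonicalAbs K x ≤ canonicalAbs K y ↔
    ValuativeRel.valuation K x ≤ ValuativeRel.valuation K y := by
  rw [← not_lt, canonicalAbs_lt_iff, not_lt]

theorem canonicalAbs_le_one_iff {x : K} : canonicalAbs K x ≤ 1 ↔ x ∈ 𝒪[K] := by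
  rw [← map_one (canonicalAbs K), canonicalAbs_le_iff, map_one, Valuation.mem_integer_iff]

theorem canonicalAbs_add_le (x y : K) :
    canonicalAbs K (x + y) ≤ max (canonicalAbs K x) (canonicalAbs K y) := by
  rcases le_max_iff.mp ((ValuativeRel.valuation K).map_add x y) with h | h
  · exact le_max_of_le_left (canonicalAbs_le_iff.mpr h)
  · exact le_max_of_le_right (canonicalAbs_le_iff.mpr h)

theorem canonicalAbs_neg (x : K) : canonicalAbs K (-x) = canonicalAbs K x :=
  le_antisymm (canonicalAbs_le_iff.mpr (Valuation.map_neg _ x).le)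
    (canonicalAbs_le_iff.mpr (Valuation.map_neg _ x).ge)

theorem canonicalAbs_sub_comm (x y : K) : canonicalAbs K (x - y) = canonicalAbs K (y - x) := by
  rw [← canonicalAbs_neg, neg_sub]

/-- Adding a term of absolute value less than `1` to one of absolute value `1`. -/
theorem canonicalAbs_add_eq_one {x y : K} (hx : canonicalAbs K x = 1) (hy : canonicalAbs K y < 1) :
    canonicalAbs K (x + y) = 1 := by
  refine le_antisymm ((canonicalAbs_add_le x y).trans (max_le hx.le hy.le)) ?_
  by_contra! h
  have h1 := canonicalAbs_add_le (x + y) (-y)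
  rw [add_neg_cancel_right, hx, canonicalAbs_neg] at h1
  exact absurd h1 (not_le.mpr (max_lt h hy))

-- The nonzero values are the integral powers of `q`, so none lies strictly between `q⁻¹` and 1.
variable (K) in
theorem exists_canonicalAbs_eq_inv : ∃ w : K, canonicalAbs K w = (resCard K : ℝ≥0)⁻¹ ∧
    ∀ x : K, canonicalAbs K x < 1 → canonicalAbs K x ≤ (resCard K : ℝ≥0)⁻¹ := by
  have h1 : (1 : ℝ≥0) < resCard K := by exact_mod_cast two_le_resCard K
  obtain ⟨w, hw⟩ := ValuativeRel.valuation_surjective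
    ((IsNonarchimedeanLocalField.valueGroupWithZeroIsoInt K).symm (WithZero.exp (-1)))
  have hexp : ∀ n : ℤ, WithZeroMulInt.toNNReal (resCard_ne_zero K) (WithZero.exp n) =
      (resCard K : ℝ≥0) ^ n := by
    intro n
    rw [WithZeroMulInt.toNNReal_neg_apply _ WithZero.exp_ne_zero]
    rfl
  refine ⟨w, ?_, fun x hx => ?_⟩
  · change WithZeroMulInt.toNNReal (resCard_ne_zero K)
      (IsNonarchimedeanLocalField.valueGroupWithZeroIsoInt K (ValuativeRel.valuation K w)) = _
    rw [hw, OrderMonoidIso.apply_symm_apply, hexp, zpow_neg_one]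
  · change WithZeroMulInt.toNNReal (resCard_ne_zero K)
      (IsNonarchimedeanLocalField.valueGroupWithZeroIsoInt K (ValuativeRel.valuation K x)) < 1 at hx
    change WithZeroMulInt.toNNReal (resCard_ne_zero K)
      (IsNonarchimedeanLocalField.valueGroupWithZeroIsoInt K (ValuativeRel.valuation K x)) ≤ _
    generalize IsNonarchimedeanLocalField.valueGroupWithZeroIsoInt K (ValuativeRel.valuation K x) = z
      at hx ⊢
    rcases eq_or_ne z 0 with rfl | hz
    · simp
    · rw [← WithZero.exp_log hz, hexp] at hx ⊢
      have hneg : z.log < 0 := by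
        by_contra! h
        exact absurd hx (not_lt.mpr (one_le_zpow₀ h1.le h))
      rw [← zpow_neg_one]
      exact zpow_le_zpow_right₀ h1.le (by omega)

theorem canonicalAbs_eq_one_of_isUnit {x : 𝒪[K]} (hx : IsUnit x) : canonicalAbs K (x : K) = 1 := by
  obtain ⟨y, hy⟩ := hx.exists_right_inv
  refine le_antisymm (canonicalAbs_le_one_iff.mpr x.2) ?_
  have h1 : canonicalAbs K (x : K) * canonicalAbs K (y : K) = 1 := by
    rw [← map_mul, ← map_one (canonicalAbs K)]
    congr 1
    exact congrArg Subtype.val hy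
  calc (1 : ℝ≥0) = canonicalAbs K (x : K) * canonicalAbs K (y : K) := h1.symm
    _ ≤ canonicalAbs K (x : K) * 1 := by
        gcongr
        exact canonicalAbs_le_one_iff.mpr y.2
    _ = canonicalAbs K (x : K) := mul_one _

theorem canonicalAbs_lt_one_of_not_isUnit {x : 𝒪[K]} (hx : ¬ IsUnit x) :
    canonicalAbs K (x : K) < 1 := by
  rw [← map_one (canonicalAbs K), canonicalAbs_lt_iff, map_one]
  exact Valuation.Integer.not_isUnit_iff_valuation_lt_one.mp hx

theorem isOpen_integer : IsOpen ((𝒪[K] : Subring K) : Set K) := by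
  rw [isOpen_iff_mem_nhds]
  intro x hx
  have h0 : {y : K | ValuativeRel.valuation K y < 1} ∈ 𝓝 (0 : K) :=
    (IsValuativeTopology.hasBasis_nhds_zero' K).mem_of_mem one_ne_zero
  have h1 : Tendsto (fun y : K => y - x) (𝓝 x) (𝓝 0) := by
    have : Continuous fun y : K => y - x := by fun_prop
    simpa using this.tendsto x
  filter_upwards [h1 h0] with y hy
  have hy' : y - x ∈ 𝒪[K] := (Valuation.mem_integer_iff _ _).mpr (le_of_lt hy)
  simpa using add_mem hy' hx

theorem continuous_canonicalAbs : Continuous fun x : K => (canonicalAbs K x : ℝ) := by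
  have h1 : (1 : ℝ≥0) < resCard K := by exact_mod_cast two_le_resCard K
  obtain ⟨w, hw, -⟩ := exists_canonicalAbs_eq_inv K
  rw [continuous_iff_continuousAt]
  intro x
  rw [ContinuousAt, Metric.tendsto_nhds]
  intro ε hε
  obtain ⟨n, hn⟩ := exists_pow_lt_of_lt_one (show (0 : ℝ≥0) < ⟨ε, hε.le⟩ from hε) (inv_lt_one_of_one_lt₀ h1)
  have hw0 : ValuativeRel.valuation K (w ^ n) ≠ 0 := by
    rw [Ne, map_eq_zero]
    refine pow_ne_zero _ ?_
    rintro rfl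
    rw [map_zero, eq_comm, inv_eq_zero] at hw
    exact resCard_ne_zero K hw
  have h2 : Tendsto (fun y : K => y - x) (𝓝 x) (𝓝 0) := by
    have : Continuous fun y : K => y - x := by fun_prop
    simpa using this.tendsto x
  filter_upwards [h2 ((IsValuativeTopology.hasBasis_nhds_zero' K).mem_of_mem hw0)] with y hy
  have h3 : canonicalAbs K (y - x) < ⟨ε, hε.le⟩ := by
    refine lt_trans (canonicalAbs_lt_iff.mpr hy) ?_
    rw [map_pow, hw]
    exact hn
  have h4 : (canonicalAbs K (y - x) : ℝ) < ε := h3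
  have h5 : ∀ a b : K, (canonicalAbs K a : ℝ) ≤ canonicalAbs K b + canonicalAbs K (a - b) := by
    intro a b
    have := (canonicalAbs_add_le b (a - b)).trans (max_le_add_of_nonneg (by simp) (by simp))
    rw [add_sub_cancel] at this
    exact_mod_cast this
  rw [Real.dist_eq, abs_lt]
  have h6 := h5 y x
  have h7 := h5 x y
  rw [canonicalAbs_sub_comm] at h7
  constructor <;> linarith

variable (K) in
theorem t2Space_of_isNonarchimedeanLocalField : T2Space K := by
  let := IsTopologicalAddGroup.rightUniformSpace K
  have := isUniformAddGroup_of_addCommGroup (G := K)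
  infer_instance

-- The neighbourhoods of 0 are pulled back along the absolute value, hence countably generated; this
-- makes the compact ring pseudometrizable, so second countable. It is needed for the distance to be
-- measurable for the product σ-algebra.
variable (K) in
theorem secondCountableTopology_integer : SecondCountableTopology 𝒪[K] := by
  have hK : (𝓝 (0 : K)).IsCountablyGenerated := by
    have hle : 𝓝 (0 : K) = Filter.comap (fun x : K => (canonicalAbs K x : ℝ)) (𝓝 0) := by
      refine le_antisymm ?_ ?_
      · rw [← tendsto_iff_comap]
        simpa using (continuous_canonicalAbs (K := K)).tendsto 0
      · refine (IsValuativeTopology.hasBasis_nhds_zero' K).ge_iff.mpr fun γ hγ => ?_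
        obtain ⟨y, rfl⟩ := ValuativeRel.valuation_surjective γ
        have hy : (0 : ℝ) < canonicalAbs K y := by
          rw [NNReal.coe_pos, pos_iff_ne_zero]
          simpa using hγ
        refine ⟨_, Iio_mem_nhds hy, fun x hx => ?_⟩
        exact canonicalAbs_lt_iff.mp (NNReal.coe_lt_coe.mp hx)
    rw [hle]
    infer_instance
  have hO : (𝓝 (0 : 𝒪[K])).IsCountablyGenerated := by
    rw [nhds_subtype_eq_comap]
    exact inferInstanceAs (Filter.comap _ (𝓝 (0 : K))).IsCountablyGenerated
  let := IsTopologicalAddGroup.rightUniformSpace 𝒪[K]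
  have := isUniformAddGroup_of_addCommGroup (G := 𝒪[K])
  have := IsUniformAddGroup.uniformity_countably_generated (α := 𝒪[K])
  let := UniformSpace.pseudoMetricSpace 𝒪[K]
  infer_instance

end AbsoluteValue

/-! ### Residue discs of R and of P¹(K). -/

noncomputable section LocalFieldCover

open scoped ENNReal
open Filter Topology

section Charts

variable {K : Type*} [Field K]

theorem vec_one_left_ne_zero (t : K) : (![1, t] : Fin 2 → K) ≠ 0 :=
  fun h => one_ne_zero (congrFun h 0)

theorem vec_one_right_ne_zero (t : K) : (![t, 1] : Fin 2 → K) ≠ 0 :=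
  fun h => one_ne_zero (congrFun h 1)

/-- The affine chart `t ↦ [1 : t]`. -/
def chartLeft (t : K) : P1 K := Projectivization.mk K ![1, t] (vec_one_left_ne_zero t)

/-- The affine chart `t ↦ [t : 1]`. -/
def chartRight (t : K) : P1 K := Projectivization.mk K ![t, 1] (vec_one_right_ne_zero t)

theorem mk_eq_chartLeft {v : Fin 2 → K} (hv : v ≠ 0) (t : K) :
    Projectivization.mk K v hv = chartLeft t ↔ v 0 ≠ 0 ∧ v 1 / v 0 = t := by
  rw [chartLeft, Projectivization.mk_eq_mk_iff']
  constructor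
  · rintro ⟨a, rfl⟩
    have ha : a ≠ 0 := by
      rintro rfl
      simp at hv
    simp [ha]
  · rintro ⟨h0, rfl⟩
    refine ⟨v 0, ?_⟩
    ext i
    fin_cases i
    · simp
    · simp [mul_div_cancel₀ _ h0]

theorem mk_eq_chartRight {v : Fin 2 → K} (hv : v ≠ 0) (t : K) :
    Projectivization.mk K v hv = chartRight t ↔ v 1 ≠ 0 ∧ v 0 / v 1 = t := by
  rw [chartRight, Projectivization.mk_eq_mk_iff']
  constructor
  · rintro ⟨a, rfl⟩
    have ha : a ≠ 0 := by
      rintro rfl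
      simp at hv
    simp [ha]
  · rintro ⟨h0, rfl⟩
    refine ⟨v 1, ?_⟩
    ext i
    fin_cases i
    · simp [mul_div_cancel₀ _ h0]
    · simp

variable [ValuativeRel K]

/-- The transformation exchanging the discs around `[0 : 1]` and `[1 : c]`. -/
def swapMatrix (c : 𝒪[K]) : GL2R K :=
  Matrix.GeneralLinearGroup.mk'' !![0, 1; 1, c] (by simp [Matrix.det_fin_two_of])

/-- The translation `[t : 1] ↦ [t + y : 1]`. -/
def shiftMatrix (y : 𝒪[K]) : GL2R K :=
  Matrix.GeneralLinearGroup.mk'' !![1, y; 0, 1] (by simp [Matrix.det_fin_two_of])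

theorem moebius_swapMatrix (c : 𝒪[K]) (t : K) :
    moebius (swapMatrix c) (chartRight t) = chartLeft (c + t) := by
  obtain ⟨hw, h⟩ := moebius_mk (swapMatrix c) ![t, 1] (vec_one_right_ne_zero t)
  rw [chartRight, h, mk_eq_chartLeft]
  have he : ∀ i j, swapMatrix c i j = !![0, 1; 1, c] i j := fun _ _ => rfl
  simp [he, add_comm]

theorem moebius_shiftMatrix (y : 𝒪[K]) (t : K) :
    moebius (shiftMatrix y) (chartRight t) = chartRight (y + t) := by
  obtain ⟨hw, h⟩ := moebius_mk (shiftMatrix y) ![t, 1] (vec_one_right_ne_zero t)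
  rw [chartRight, h, mk_eq_chartRight]
  have he : ∀ i j, shiftMatrix y i j = !![1, y; 0, 1] i j := fun _ _ => rfl
  simp [he, add_comm]

end Charts

variable (K : Type*) [Field K] [ValuativeRel K] [TopologicalSpace K] [IsNonarchimedeanLocalField K]

/-- The Borel σ-algebra of the ring of integers. -/
instance instMeasurableSpaceInteger : MeasurableSpace 𝒪[K] := borel 𝒪[K]

instance instBorelSpaceInteger : BorelSpace 𝒪[K] := ⟨rfl⟩

/-- The Haar probability measure on the ring of integers. -/
def haarInteger : Measure 𝒪[K] := Measure.addHaarMeasure ⊤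

instance instIsAddHaarMeasureHaarInteger : (haarInteger K).IsAddHaarMeasure :=
  inferInstanceAs (Measure.addHaarMeasure ⊤).IsAddHaarMeasure

instance instIsProbabilityMeasureHaarInteger : IsProbabilityMeasure (haarInteger K) :=
  ⟨Measure.addHaarMeasure_self (K₀ := ⊤)⟩

variable {K}

/-- The distance `|x - y|` on the ring of integers. -/
def integerDist (x y : 𝒪[K]) : ℝ := canonicalAbs K ((x : K) - y)

theorem integerDist_nonneg (x y : 𝒪[K]) : 0 ≤ integerDist x y := NNReal.coe_nonneg _

theorem integerDist_le_one (x y : 𝒪[K]) : integerDist x y ≤ 1 := by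
  have : canonicalAbs K ((x : K) - y) ≤ 1 := canonicalAbs_le_one_iff.mpr (sub_mem x.2 y.2)
  exact_mod_cast this

theorem measurable_integerDist : Measurable fun p : 𝒪[K] × 𝒪[K] => integerDist p.1 p.2 := by
  have := secondCountableTopology_integer K
  have h : Continuous fun p : 𝒪[K] × 𝒪[K] => integerDist p.1 p.2 :=
    continuous_canonicalAbs.comp
      ((continuous_subtype_val.comp continuous_fst).sub (continuous_subtype_val.comp continuous_snd))
  exact h.measurable

/-- Pulled back along the piece `b₀`, `ν` is a finite translation-invariant measure on a compact
group, hence a multiple of Haar measure. By `htrans` the other pieces have the same measure, and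
total mass 1 determines the multiple. -/
theorem eq_sum_map_haarInteger {Y B : Type*} [MeasurableSpace Y] [Fintype B] (ν : Measure Y)
    [IsProbabilityMeasure ν] (ψ : B → 𝒪[K] → Y) (hψ : ∀ b, MeasurableEmbedding (ψ b))
    (hdisj : ∀ b c x y, b ≠ c → ψ b x ≠ ψ c y) (hcover : ∀ z, ∃ b x, ψ b x = z) (b₀ : B)
    (htrans : ∀ b E, MeasurableSet E → ν (ψ b '' E) = ν (ψ b₀ '' E))
    (hinv : ∀ (y : 𝒪[K]) E, MeasurableSet E → ν (ψ b₀ '' ((y + ·) '' E)) = ν (ψ b₀ '' E)) :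
    ν = ∑ b, (Fintype.card B : ℝ≥0∞)⁻¹ • (haarInteger K).map (ψ b) := by
  set ν₀ : Measure 𝒪[K] := ν.comap (ψ b₀) with hν₀
  have hν₀apply : ∀ E, ν₀ E = ν (ψ b₀ '' E) := fun E => (hψ b₀).comap_apply ν E
  have hfin : IsFiniteMeasure ν₀ := ⟨by rw [hν₀apply]; exact measure_lt_top _ _⟩
  have hleft : ν₀.IsAddLeftInvariant := by
    rw [← forall_measure_preimage_add_iff]
    intro g A hA
    rw [hν₀apply, hν₀apply, ← hinv (-g) A hA, Set.image_add_left, neg_neg]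
  have hsmul := Measure.isAddInvariant_eq_smul_of_compactSpace ν₀ (haarInteger K)
  set c : ℝ≥0 := ν₀.addHaarScalarFactor (haarInteger K) with hc
  have hsum : ∀ M, MeasurableSet M → ν M = ∑ b, (c : ℝ≥0∞) * haarInteger K (ψ b ⁻¹' M) := by
    intro M hM
    have hU : M = ⋃ b, ψ b '' (ψ b ⁻¹' M) := by
      ext z
      simp only [Set.mem_iUnion, Set.mem_image, Set.mem_preimage]
      constructor
      · intro hz
        obtain ⟨b, x, rfl⟩ := hcover z
        exact ⟨b, x, hz, rfl⟩
      · rintro ⟨b, x, hx, rfl⟩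
        exact hx
    conv_lhs => rw [hU]
    rw [measure_iUnion, tsum_fintype]
    · refine Finset.sum_congr rfl fun b _ => ?_
      rw [htrans b _ ((hψ b).measurable hM), ← hν₀apply, hsmul]
      rfl
    · intro b b' hb
      rw [Function.onFun, Set.disjoint_left]
      rintro _ ⟨x, -, rfl⟩ ⟨y, -, hy⟩
      exact hdisj b' b y x hb.symm hy
    · exact fun b => (hψ b).measurableSet_image' ((hψ b).measurable hM)
  have hc1 : (Fintype.card B : ℝ≥0∞) * c = 1 := by
    have := hsum Set.univ MeasurableSet.univ
    simp only [measure_univ, Set.preimage_univ, mul_one, Finset.sum_const, nsmul_eq_mul,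
      Finset.card_univ] at this
    exact this.symm
  have hc2 : (c : ℝ≥0∞) = (Fintype.card B : ℝ≥0∞)⁻¹ :=
    ENNReal.eq_inv_of_mul_eq_one_left (by rw [mul_comm]; exact hc1)
  ext M hM
  rw [hsum M hM, Measure.finsetSum_apply]
  refine Finset.sum_congr rfl fun b _ => ?_
  rw [Measure.smul_apply, Measure.map_apply (hψ b).measurable hM, hc2, smul_eq_mul]

/-- A representative of a residue class. -/
def digit (a : 𝓀[K]) : 𝒪[K] := Function.surjInv IsLocalRing.residue_surjective a

theorem residue_digit (a : 𝓀[K]) : IsLocalRing.residue 𝒪[K] (digit a) = a :=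
  Function.surjInv_eq _ a

variable (K) in
/-- A uniformizer of the ring of integers. -/
def uniformizer : 𝒪[K] :=
  ⟨(exists_canonicalAbs_eq_inv K).choose, canonicalAbs_le_one_iff.mp <| by
    rw [(exists_canonicalAbs_eq_inv K).choose_spec.1]
    exact inv_le_one_of_one_le₀ (by exact_mod_cast (two_le_resCard K).trans' one_le_two)⟩

variable (K) in
theorem canonicalAbs_uniformizer : canonicalAbs K (uniformizer K : K) = (resCard K : ℝ≥0)⁻¹ :=
  (exists_canonicalAbs_eq_inv K).choose_spec.1

variable (K) in
theorem uniformizer_ne_zero : (uniformizer K : K) ≠ 0 := by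
  intro h
  have := canonicalAbs_uniformizer K
  rw [h, map_zero, eq_comm, inv_eq_zero] at this
  exact resCard_ne_zero K this

theorem canonicalAbs_uniformizer_mul_lt (x : 𝒪[K]) :
    canonicalAbs K ((uniformizer K : K) * x) < 1 := by
  have h1 : (1 : ℝ≥0) < resCard K := by exact_mod_cast two_le_resCard K
  rw [map_mul, canonicalAbs_uniformizer]
  exact mul_lt_one_of_nonneg_of_lt_one_left (by simp) (inv_lt_one_of_one_lt₀ h1)
    (canonicalAbs_le_one_iff.mpr x.2)

theorem exists_eq_uniformizer_mul {y : K} (hy : canonicalAbs K y < 1) :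
    ∃ x : 𝒪[K], y = uniformizer K * x := by
  refine ⟨⟨y / uniformizer K, canonicalAbs_le_one_iff.mp ?_⟩, ?_⟩
  · rw [map_div₀, canonicalAbs_uniformizer, div_inv_eq_mul]
    have h := (exists_canonicalAbs_eq_inv K).choose_spec.2 y hy
    calc canonicalAbs K y * resCard K ≤ (resCard K : ℝ≥0)⁻¹ * resCard K := by gcongr
      _ = 1 := inv_mul_cancel₀ (resCard_ne_zero K)
  · rw [mul_div_cancel₀ _ (uniformizer_ne_zero K)]

theorem exists_eq_digit_add {y : K} (hy : canonicalAbs K y ≤ 1) :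
    ∃ (a : 𝓀[K]) (x : 𝒪[K]), y = digit a + uniformizer K * x := by
  let y' : 𝒪[K] := ⟨y, canonicalAbs_le_one_iff.mp hy⟩
  let a := IsLocalRing.residue 𝒪[K] y'
  have h1 : ¬ IsUnit (y' - digit a) := by
    have h2 : IsLocalRing.residue 𝒪[K] (y' - digit a) = 0 := by
      rw [map_sub, residue_digit, sub_self]
    rw [IsLocalRing.residue_eq_zero_iff] at h2
    exact (IsLocalRing.mem_maximalIdeal _).mp h2
  obtain ⟨x, hx⟩ := exists_eq_uniformizer_mul (canonicalAbs_lt_one_of_not_isUnit h1)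
  refine ⟨a, x, ?_⟩
  rw [← hx]
  simp [y']

theorem canonicalAbs_digit_sub {a b : 𝓀[K]} (hab : a ≠ b) (x y : 𝒪[K]) :
    canonicalAbs K ((digit a + uniformizer K * x : K) - (digit b + uniformizer K * y)) = 1 := by
  have h1 : IsUnit (digit a - digit b) := by
    by_contra h
    have h2 := (IsLocalRing.residue_eq_zero_iff _).mpr ((IsLocalRing.mem_maximalIdeal _).mpr h)
    rw [map_sub, residue_digit, residue_digit, sub_eq_zero] at h2
    exact hab h2
  rw [show (digit a + uniformizer K * x : K) - (digit b + uniformizer K * y) =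
    ((digit a - digit b : 𝒪[K]) : K) + uniformizer K * (x - y : 𝒪[K]) by push_cast; ring]
  exact canonicalAbs_add_eq_one (canonicalAbs_eq_one_of_isUnit h1)
    (canonicalAbs_uniformizer_mul_lt _)

theorem isOpenEmbedding_add_uniformizer_mul (c : K) :
    IsOpenEmbedding fun x : 𝒪[K] => c + uniformizer K * (x : K) := by
  have h1 : IsOpenEmbedding ((↑) : 𝒪[K] → K) := isOpen_integer.isOpenEmbedding_subtypeVal
  exact (Homeomorph.addLeft c).isOpenEmbedding.comp
    ((Homeomorph.mulLeft₀ _ (uniformizer_ne_zero K)).isOpenEmbedding.comp h1)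

theorem resCard_eq_card [Fintype 𝓀[K]] : Fintype.card 𝓀[K] = resCard K :=
  Nat.card_eq_fintype_card.symm

/-- The inclusion of a residue class, rescaled. -/
def residueDisc (a : 𝓀[K]) (x : 𝒪[K]) : 𝒪[K] := digit a + uniformizer K * x

theorem isOpenEmbedding_residueDisc (a : 𝓀[K]) : IsOpenEmbedding (residueDisc a) :=
  IsOpenEmbedding.of_comp _ isOpen_integer.isOpenEmbedding_subtypeVal
    (isOpenEmbedding_add_uniformizer_mul (digit a : K))

theorem isCover_integer [Fintype 𝓀[K]] :
    IsCover (resCard K) (haarInteger K) integerDist (haarInteger K) integerDist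
      (residueDisc (K := K)) := by
  have hemb : ∀ a : 𝓀[K], MeasurableEmbedding (residueDisc a) := fun a =>
    (isOpenEmbedding_residueDisc a).measurableEmbedding
  have hne : ∀ (a b : 𝓀[K]) (x y : 𝒪[K]), a ≠ b → integerDist (residueDisc a x) (residueDisc b y) = 1 := by
    intro a b x y hab
    have h := canonicalAbs_digit_sub hab x y
    exact congrArg NNReal.toReal h
  have himg : ∀ (c : 𝒪[K]) (E : Set 𝒪[K]), haarInteger K ((c + ·) '' E) = haarInteger K E := by
    intro c E
    rw [Set.image_add_left, measure_preimage_add]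
  refine ⟨fun a => (hemb a).measurable, ?_, ?_, hne⟩
  · refine eq_sum_map_haarInteger _ _ hemb ?_ ?_ 0 ?_ ?_
    · intro b c x y hbc h
      have := hne b c x y hbc
      rw [h, integerDist, sub_self, map_zero] at this
      simp at this
    · intro z
      obtain ⟨a, x, h⟩ := exists_eq_digit_add (canonicalAbs_le_one_iff.mpr z.2)
      exact ⟨a, x, Subtype.ext h.symm⟩
    · intro b E _
      have : residueDisc b '' E = (digit b - digit 0 + ·) '' (residueDisc 0 '' E) := by
        rw [Set.image_image]
        refine Set.image_congr fun x _ => ?_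
        simp only [residueDisc]
        ring
      rw [this, himg]
    · intro y E _
      have : residueDisc 0 '' ((y + ·) '' E) = (uniformizer K * y + ·) '' (residueDisc 0 '' E) := by
        rw [Set.image_image, Set.image_image]
        refine Set.image_congr fun x _ => ?_
        simp only [residueDisc]
        ring
      rw [this, himg]
  · intro a x y
    have : ((residueDisc a x : K) - residueDisc a y) = uniformizer K * ((x : K) - y) := by
      simp only [residueDisc]
      push_cast
      ring
    rw [integerDist, this, map_mul, canonicalAbs_uniformizer, integerDist]
    push_cast
    rfl

/-- The preimage of `κ '' E` in K² ∖ 0 consists of the `v` with `v i ≠ 0` and `v j / v i ∈ E`, which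
is open when `E` is. This treats both affine charts at once. -/
theorem isOpenEmbedding_chart {κ : K → P1 K} (hcont : Continuous κ) {i j : Fin 2}
    (h : ∀ (v : Fin 2 → K) (hv : v ≠ 0) t, Projectivization.mk K v hv = κ t ↔
      v i ≠ 0 ∧ v j / v i = t) : IsOpenEmbedding κ := by
  have := t2Space_of_isNonarchimedeanLocalField K
  refine IsOpenEmbedding.of_continuous_injective_isOpenMap hcont ?_ ?_
  · intro t t' htt'
    have h1 := (h _ (κ t).rep_nonzero t).mp (κ t).mk_rep
    have h2 := (h _ (κ t).rep_nonzero t').mp ((κ t).mk_rep.trans htt')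
    exact h1.2.symm.trans h2.2
  · intro E hE
    rw [isOpen_coinduced]
    have hpre : (Projectivization.mk' K : {v : Fin 2 → K // v ≠ 0} → P1 K) ⁻¹' (κ '' E) =
        {v | v.1 i ≠ 0} ∩ (fun v => v.1 j / v.1 i) ⁻¹' E := by
      ext v
      simp only [Set.mem_preimage, Set.mem_image, Set.mem_inter_iff, Set.mem_ofPred_eq]
      constructor
      · rintro ⟨t, ht, hv⟩
        obtain ⟨h1, rfl⟩ := (h v.1 v.2 t).mp hv.symm
        exact ⟨h1, ht⟩
      · rintro ⟨h1, h2⟩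
        exact ⟨_, h2, ((h v.1 v.2 _).mpr ⟨h1, rfl⟩).symm⟩
    rw [hpre]
    have hc : ∀ k, Continuous fun v : {v : Fin 2 → K // v ≠ 0} => v.1 k := fun k =>
      (continuous_apply k).comp continuous_subtype_val
    refine ContinuousOn.isOpen_inter_preimage ?_ (isOpen_ne_fun (hc i) continuous_const) hE
    exact (hc j).continuousOn.div (hc i).continuousOn fun v hv => hv

theorem isOpenEmbedding_chartLeft : IsOpenEmbedding (chartLeft (K := K)) := by
  refine isOpenEmbedding_chart ?_ (i := 0) (j := 1) fun v hv t => mk_eq_chartLeft hv t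
  have h : Continuous fun t : K => (![1, t] : Fin 2 → K) := by
    refine continuous_pi fun i => ?_
    fin_cases i
    · exact continuous_const
    · exact continuous_id
  exact continuous_coinduced_rng.comp (h.subtype_mk vec_one_left_ne_zero)

theorem isOpenEmbedding_chartRight : IsOpenEmbedding (chartRight (K := K)) := by
  refine isOpenEmbedding_chart ?_ (i := 1) (j := 0) fun v hv t => mk_eq_chartRight hv t
  have h : Continuous fun t : K => (![t, 1] : Fin 2 → K) := by
    refine continuous_pi fun i => ?_
    fin_cases i
    · exact continuous_id
    · exact continuous_const
  exact continuous_coinduced_rng.comp (h.subtype_mk vec_one_right_ne_zero)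

/-- The residue discs of the projective line; `none` is the disc around `[0 : 1]`. -/
def projDisc : Option 𝓀[K] → 𝒪[K] → P1 K
  | some a, x => chartLeft (digit a + uniformizer K * x)
  | none, x => chartRight (uniformizer K * x)

theorem isOpenEmbedding_projDisc (b : Option 𝓀[K]) : IsOpenEmbedding (projDisc b) := by
  cases b with
  | some a => exact isOpenEmbedding_chartLeft.comp (isOpenEmbedding_add_uniformizer_mul _)
  | none =>
    have h := isOpenEmbedding_chartRight.comp (isOpenEmbedding_add_uniformizer_mul (0 : K))
    simp only [zero_add] at h
    exact h

theorem canonicalAbs_digit_add_le (a : 𝓀[K]) (x : 𝒪[K]) :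
    canonicalAbs K (digit a + uniformizer K * x) ≤ 1 :=
  canonicalAbs_le_one_iff.mpr (digit a + uniformizer K * x).2

theorem sphericalDist_chartLeft {t u : K} (ht : canonicalAbs K t ≤ 1) (hu : canonicalAbs K u ≤ 1) :
    sphericalDist (chartLeft t) (chartLeft u) = canonicalAbs K (u - t) := by
  rw [chartLeft, chartLeft, sphericalDist_mk]
  have ht' : (canonicalAbs K t : ℝ) ≤ 1 := by exact_mod_cast ht
  have hu' : (canonicalAbs K u : ℝ) ≤ 1 := by exact_mod_cast hu
  simp [max_eq_left ht', max_eq_left hu']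

theorem sphericalDist_chartRight {t u : K} (ht : canonicalAbs K t ≤ 1) (hu : canonicalAbs K u ≤ 1) :
    sphericalDist (chartRight t) (chartRight u) = canonicalAbs K (t - u) := by
  rw [chartRight, chartRight, sphericalDist_mk]
  have ht' : (canonicalAbs K t : ℝ) ≤ 1 := by exact_mod_cast ht
  have hu' : (canonicalAbs K u : ℝ) ≤ 1 := by exact_mod_cast hu
  simp [max_eq_right ht', max_eq_right hu']

theorem sphericalDist_chartLeft_chartRight {t u : K} (ht : canonicalAbs K t ≤ 1)
    (hu : canonicalAbs K u < 1) : sphericalDist (chartLeft t) (chartRight u) = 1 := by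
  rw [chartLeft, chartRight, sphericalDist_mk]
  have ht' : (canonicalAbs K t : ℝ) ≤ 1 := by exact_mod_cast ht
  have hu' : (canonicalAbs K u : ℝ) ≤ 1 := by exact_mod_cast hu.le
  have h : canonicalAbs K (1 + -(t * u)) = 1 := by
    refine canonicalAbs_add_eq_one (map_one _) ?_
    rw [canonicalAbs_neg, map_mul]
    exact mul_lt_one_of_nonneg_of_lt_one_right ht (by simp) hu
  rw [← sub_eq_add_neg] at h
  simp [max_eq_left ht', max_eq_right hu', h]

theorem sphericalDist_comm (x y : P1 K) : sphericalDist x y = sphericalDist y x := by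
  unfold sphericalDist
  rw [canonicalAbs_sub_comm, mul_comm (max _ _)]
  congr 3
  ring

theorem sphericalDist_projDisc_same (b : Option 𝓀[K]) (x y : 𝒪[K]) :
    sphericalDist (projDisc b x) (projDisc b y) = (resCard K : ℝ)⁻¹ * integerDist x y := by
  have h : ∀ z : K, (canonicalAbs K (uniformizer K * z) : ℝ) = (resCard K : ℝ)⁻¹ * canonicalAbs K z := by
    intro z
    rw [map_mul, canonicalAbs_uniformizer]
    push_cast
    rfl
  cases b with
  | some a =>
    rw [projDisc, projDisc, sphericalDist_chartLeft (canonicalAbs_digit_add_le a x)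
      (canonicalAbs_digit_add_le a y), canonicalAbs_sub_comm, add_sub_add_left_eq_sub, ← mul_sub, h]
    rfl
  | none =>
    rw [projDisc, projDisc, sphericalDist_chartRight (canonicalAbs_uniformizer_mul_lt x).le
      (canonicalAbs_uniformizer_mul_lt y).le, ← mul_sub, h]
    rfl

theorem sphericalDist_projDisc_ne {b c : Option 𝓀[K]} (hbc : b ≠ c) (x y : 𝒪[K]) :
    sphericalDist (projDisc b x) (projDisc c y) = 1 := by
  cases b with
  | some a =>
    cases c with
    | some a' =>
      rw [projDisc, projDisc, sphericalDist_chartLeft (canonicalAbs_digit_add_le _ _)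
        (canonicalAbs_digit_add_le _ _), canonicalAbs_sub_comm,
        canonicalAbs_digit_sub fun h => hbc (congrArg some h)]
      simp
    | none =>
      exact sphericalDist_chartLeft_chartRight (canonicalAbs_digit_add_le _ _)
        (canonicalAbs_uniformizer_mul_lt _)
  | none =>
    cases c with
    | some a' =>
      rw [sphericalDist_comm]
      exact sphericalDist_chartLeft_chartRight (canonicalAbs_digit_add_le _ _)
        (canonicalAbs_uniformizer_mul_lt _)
    | none => exact absurd rfl hbc

theorem exists_projDisc_eq (z : P1 K) : ∃ (b : Option 𝓀[K]) (x : 𝒪[K]), projDisc b x = z := by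
  induction z using Projectivization.ind with
  | h v hv =>
    rcases le_or_gt (canonicalAbs K (v 1)) (canonicalAbs K (v 0)) with h | h
    · have h0 : v 0 ≠ 0 := by
        intro h0
        rw [h0, map_zero, le_zero_iff, map_eq_zero] at h
        refine hv (funext fun i => ?_)
        fin_cases i
        · exact h0
        · exact h
      have h1 : canonicalAbs K (v 1 / v 0) ≤ 1 := by
        rw [map_div₀]
        exact div_le_one_of_le₀ h (by simp)
      obtain ⟨a, x, hx⟩ := exists_eq_digit_add h1
      exact ⟨some a, x, ((mk_eq_chartLeft hv _).mpr ⟨h0, hx⟩).symm⟩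
    · have h0 : v 1 ≠ 0 := by
        intro h0
        rw [h0, map_zero] at h
        exact not_lt_zero h
      have h1 : canonicalAbs K (v 0 / v 1) < 1 := by
        rw [map_div₀]
        exact (div_lt_one₀ (by rw [pos_iff_ne_zero]; simpa using h0)).mpr h
      obtain ⟨x, hx⟩ := exists_eq_uniformizer_mul h1
      exact ⟨none, x, ((mk_eq_chartRight hv _).mpr ⟨h0, hx⟩).symm⟩

/-- Invariance of `ν` enters through two kinds of matrices only: `swapMatrix` carries the disc
around [0 : 1] onto each other disc, and `shiftMatrix` realises the translations inside it. -/
theorem isCover_projDisc [Fintype 𝓀[K]] {ν : Measure (P1 K)} [IsProbabilityMeasure ν]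
    (hν : IsPGLInvariant ν) :
    IsCover (resCard K) (haarInteger K) integerDist ν sphericalDist (projDisc (K := K)) := by
  have hemb : ∀ b : Option 𝓀[K], MeasurableEmbedding (projDisc b) := fun b =>
    (isOpenEmbedding_projDisc b).measurableEmbedding
  refine ⟨fun b => (hemb b).measurable, ?_, sphericalDist_projDisc_same,
    fun b c x y hbc => sphericalDist_projDisc_ne hbc x y⟩
  refine eq_sum_map_haarInteger ν _ hemb ?_ exists_projDisc_eq none ?_ ?_
  · intro b c x y hbc h
    have h1 := sphericalDist_projDisc_ne hbc x y
    have h2 := sphericalDist_projDisc_same c y y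
    rw [← h, h] at h1
    rw [integerDist, sub_self, map_zero, h1] at h2
    simp at h2
  · intro b E hE
    cases b with
    | none => rfl
    | some a =>
      have : projDisc (some a) '' E = moebius (swapMatrix (digit a)) '' (projDisc none '' E) := by
        rw [Set.image_image]
        refine Set.image_congr fun x _ => ?_
        rw [projDisc, projDisc, moebius_swapMatrix]
      rw [this, hν _ _ ((hemb none).measurableSet_image' hE)]
  · intro y E hE
    have : projDisc none '' ((y + ·) '' E) =
        moebius (shiftMatrix (uniformizer K * y)) '' (projDisc none '' E) := by
      rw [Set.image_image, Set.image_image]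
      refine Set.image_congr fun x _ => ?_
      rw [projDisc, projDisc, moebius_shiftMatrix]
      congr 1
      push_cast
      ring
    rw [this, hν _ _ ((hemb none).measurableSet_image' hE)]

/-- On each of the finitely many products of two discs the distance is either 1 or a multiple of
`integerDist`, so no second countability of the projective line is needed. -/
theorem measurable_sphericalDist : Measurable fun p : P1 K × P1 K => sphericalDist p.1 p.2 := by
  have hemb : ∀ b : Option 𝓀[K], MeasurableEmbedding (projDisc b) := fun b =>
    (isOpenEmbedding_projDisc b).measurableEmbedding
  intro U hU
  have hU' : (fun p : P1 K × P1 K => sphericalDist p.1 p.2) ⁻¹' U =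
      ⋃ bc : Option 𝓀[K] × Option 𝓀[K], Prod.map (projDisc bc.1) (projDisc bc.2) ''
        ((fun p : 𝒪[K] × 𝒪[K] => sphericalDist (projDisc bc.1 p.1) (projDisc bc.2 p.2)) ⁻¹' U) := by
    ext ⟨y, z⟩
    simp only [Set.mem_iUnion, Set.mem_preimage, Set.mem_image]
    constructor
    · intro h
      obtain ⟨b, x, rfl⟩ := exists_projDisc_eq y
      obtain ⟨c, x', rfl⟩ := exists_projDisc_eq z
      exact ⟨(b, c), (x, x'), h, rfl⟩
    · rintro ⟨bc, p, hp, h⟩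
      obtain ⟨rfl, rfl⟩ := Prod.mk.inj h
      exact hp
  rw [hU']
  refine MeasurableSet.iUnion fun bc => ((hemb bc.1).prodMap (hemb bc.2)).measurableSet_image' ?_
  have hm : Measurable fun p : 𝒪[K] × 𝒪[K] =>
      sphericalDist (projDisc bc.1 p.1) (projDisc bc.2 p.2) := by
    by_cases h : bc.1 = bc.2
    · rw [h]
      simp only [sphericalDist_projDisc_same]
      exact measurable_integerDist.const_mul _
    · simp only [sphericalDist_projDisc_ne h]
      exact measurable_const
  exact hm hU

end LocalFieldCover

end LogCoulomb

theorem theorem2p1 {K : Type*} [Field K] [ValuativeRel K] [TopologicalSpace K]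
    [IsNonarchimedeanLocalField K] (ν : MeasureTheory.Measure (LogCoulomb.P1 K))
    [MeasureTheory.IsProbabilityMeasure ν] (hν : LogCoulomb.IsPGLInvariant ν)
    (N : ℕ) (hN : 2 ≤ N) (s : Fin N → Fin N → ℂ) :
    (MeasureTheory.Integrable (LogCoulomb.integrand s)
        (MeasureTheory.Measure.pi fun _ : Fin N => ν) ↔ s ∈ LogCoulomb.Omega N) ∧
    (s ∈ LogCoulomb.Omega N →
      ∫ x, LogCoulomb.integrand s x ∂(MeasureTheory.Measure.pi fun _ : Fin N => ν) =
        1 / ((LogCoulomb.resCard K : ℂ) + 1) ^ (N - 1) *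
          ∑ c : LogCoulomb.ReducedChain N, LogCoulomb.summand (LogCoulomb.resCard K) s c.1) ∧
    -- the summand is the expression with denominator `q + 1 - deg [N]`, that denominator being
    -- cancelled by a factor of `(q - 1)_{deg [N] - 1}` (as polynomials in `q - 1`)
    (∀ c : LogCoulomb.ReducedChain N,
      (c.1.deg Finset.univ ≠ LogCoulomb.resCard K + 1 →
        LogCoulomb.summand (LogCoulomb.resCard K) s c.1 =
          ((LogCoulomb.resCard K : ℂ) ^ ((N : ℂ) + ∑ i, ∑ j with i < j, s i j) + 1 -
              (c.1.deg Finset.univ : ℂ)) /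
            ((LogCoulomb.resCard K : ℂ) + 1 - (c.1.deg Finset.univ : ℂ)) *
          ∏ lam ∈ c.1.branches,
            LogCoulomb.fall (LogCoulomb.resCard K) (c.1.deg lam - 1) /
              ((LogCoulomb.resCard K : ℂ) ^ LogCoulomb.expo s lam - 1)) ∧
      2 ≤ c.1.deg Finset.univ ∧
      descPochhammer ℤ (c.1.deg Finset.univ - 1) =
        (Polynomial.X + 2 - ((c.1.deg Finset.univ : ℕ) : Polynomial ℤ)) *
          descPochhammer ℤ (c.1.deg Finset.univ - 2)) := by
  classical
  have : Fintype 𝓀[K] := Fintype.ofFinite _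
  have hq := LogCoulomb.two_le_resCard K
  have hA : Fintype.card 𝓀[K] = LogCoulomb.resCard K := LogCoulomb.resCard_eq_card
  have hB : Fintype.card (Option 𝓀[K]) = LogCoulomb.resCard K + 1 := by
    rw [Fintype.card_option, hA]
  have hX := LogCoulomb.isCover_integer (K := K)
  have hY := LogCoulomb.isCover_projDisc hν
  refine ⟨?_, fun hs => ?_, fun c => ⟨fun hc => ?_, LogCoulomb.two_le_deg_univ hN c.1,
    LogCoulomb.descPochhammer_cancel (LogCoulomb.two_le_deg_univ hN c.1)⟩⟩
  -- By definition `integrand s` is `pairProd s sphericalDist Finset.univ`.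
  · exact LogCoulomb.integrable_pairProd_univ_iff s hq hX hA LogCoulomb.integerDist_nonneg
      LogCoulomb.integerDist_le_one LogCoulomb.measurable_integerDist hY hB
      LogCoulomb.measurable_sphericalDist
  · exact LogCoulomb.integral_pairProd_univ s hN hq hX hA LogCoulomb.integerDist_nonneg
      LogCoulomb.integerDist_le_one LogCoulomb.measurable_integerDist hY hB
      LogCoulomb.measurable_sphericalDist hs
  · exact LogCoulomb.summand_eq hN _ s c.1 hc
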